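/- Let $C(t)=\sum_k |a_k|^2 e^{i\omega_k t}$ be a signal with distinct real frequencies $\omega_k$ (finitely or infinitely many) such that $\sum_k |a_k|^2<\infty$ and $\sum_k|\omega_k||a_k|^2<\infty$. Let $W,T>0$, $\omega^*\in\mathbb R$, let $B=[\omega^*-W,\omega^*+W]$, and suppose that exactly $m$ frequencies, $1\le m<\infty$, lie in $B$. Let $\rho_W(x)=\frac{\sin Wx}{\pi x}$, and let $(\xi_n)_{n\ge0}$ be the $WT$-prolates: the real eigenfunctions, orthonormal in $L^2(\mathbb R)$ and complete in $L^2([-T,T])$, of the integral equation $\int_{-T}^{T}\rho_W(s-t)\xi_n(t)\,dt=\gamma_n\xi_n(s)$, $s\in\mathbb R$, ordered so that $\gamma_0\ge\gamma_1\ge\dots>0$. Let $\tilde\xi_n(\omega)=\sqrt{T/W}\,\xi_n(T\omega/W)$ be the dual prolates and let $\lambda_n$ be the eigenvalue in the prolate differential equation $$(W^2-\omega^2)\tilde\xi_n''(\omega)-2\omega\tilde\xi_n'(\omega)+T^2(W^2-\omega^2)\tilde\xi_n(\omega)=-\lambda_n\tilde\xi_n(\omega),\qquad \omega\in\mathbb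 R .$$ Put $$C_{\mathrm{extra},n}=\sqrt{\|\tilde\xi_n'\|_{L^2(\mathbb R)}^2-\frac{\lambda_n}{W}\,\frac{\tilde\xi_n(W)^2}{1-\gamma_n}},\qquad \tilde\varepsilon_M=2\pi\sum_{l=0}^{M-1}\gamma_l(1-\gamma_l)\,C_{\mathrm{extra},l}.$$ For $M\ge m$ form, from the values of $C$ on $[-2T,2T]$, the $M\times M$ matrices ($0\le s,l<M$) $$(\mathbf V^2_M)_{sl}=\int_{-T}^{T}\!\int_{-T}^{T}e^{-i\omega^*(\tau-t)}\xi_s(\tau)\xi_l(t)\,C(\tau-t)\,d\tau\,dt,$$ $$(\mathbf H_{V_M})_{sl}=i\int_{-T}^{T}\!\int_{-T}^{T}e^{-i\omega^*(\tau-t)}\xi_s(\tau)\xi_l(t)\,\partial_tC(\tau-t)\,d\tau\,dt .$$ Choose a unitary $\mathbf U$ with $\mathbf U^\dagger\mathbf V_M^2\mathbf U=\operatorname{diag}(\lambda_1(\mathbf V_M^2),\dots,\lambda_M(\mathbf V_M^2))$, eigenvalues in decreasing order, and let $\mathbf V_*^2=\operatorname{diag}(\lambda_1(\mathbf V_M^2),\dots,\lambda_m(\mathbf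 V_M^2))$ and $\mathbf H_{V_*}$ be the leading $m\times m$ block of $\mathbf U^\dagger\mathbf H_{V_M}\mathbf U$. Assume that $\lambda_m(\mathbf V_M^2)>\tilde\varepsilon_M\,C(0)$. Let $\tilde\omega_1\ge\dots\ge\tilde\omega_m$ be the eigenvalues, counted with multiplicity, of the generalized eigenvalue problem $\mathbf H_{V_*}x=\tilde\omega\,\mathbf V_*^2x$, and let $\omega_1>\dots>\omega_m$ denote the frequencies of $C$ in $B$. Then for every $k=1,\dots,m$ $$\tilde\varepsilon_M\,\frac{\sum_{\omega_l<\omega^*-W}(\omega_l-\omega_k)|a_l|^2}{\lambda_m(\mathbf V_M^2)-\tilde\varepsilon_M C(0)}\;\le\;\tilde\omega_k-\omega_k\;\le\;\tilde\varepsilon_M\,\frac{\sum_{\omega_l>\omega^*+W}(\omega_l-\omega_k)|a_l|^2}{\lambda_m(\mathbf V_M^2)-\tilde\varepsilon_M C(0)} ,$$ where the sums run over all frequencies $\omega_l$ of the signal in the indicated range. -/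

import Mathlib

open MeasureTheory

noncomputable section

namespace PFD

/-- The sampling kernel `ρ_W(x) = sin(W x) / (π x)`, with `ρ_W(0) = W / π`. -/
def rho (W x : ℝ) : ℝ := W / Real.pi * Real.sinc (W * x)

/-- `ξ` is the sequence of `W T`-prolates and `γ` the sequence of their eigenvalues: the `ξ n` are
the eigenfunctions of `f ↦ ∫_{-T}^{T} ρ_W(· - t) f(t) dt` with nonzero eigenvalue, listed by
decreasing eigenvalue and normalized over the whole real line; the list is complete. -/
structure IsProlateSequence (W T : ℝ) (γ : ℕ → ℝ) (ξ : ℕ → ℝ → ℝ) : Prop where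
  memLp : ∀ n, MemLp (ξ n) 2 volume
  eigen : ∀ n s, ∫ t in (-T)..T, rho W (s - t) * ξ n t = γ n * ξ n s
  pos : ∀ n, 0 < γ n
  anti : Antitone γ
  orthonormal : ∀ n k, ∫ t, ξ n t * ξ k t = if n = k then 1 else 0
  complete : ∀ f : ℝ → ℝ, MemLp f 2 (volume.restrict (Set.Icc (-T) T)) →
    (∀ n, ∫ t in (-T)..T, f t * ξ n t = 0) → f =ᵐ[volume.restrict (Set.Icc (-T) T)] 0

/-- The prolate spheroidal differential operator
`f ↦ (T² - t²) f'' - 2 t f' + W² (T² - t²) f`. -/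
def spheroidalOp (W T : ℝ) (f : ℝ → ℝ) (t : ℝ) : ℝ :=
  (T ^ 2 - t ^ 2) * deriv (deriv f) t - 2 * t * deriv f t + W ^ 2 * (T ^ 2 - t ^ 2) * f t

/-- The number `lam` with `spheroidalOp W T f = -lam • f`. -/
def spheroidalEigenvalue (W T : ℝ) (f : ℝ → ℝ) : ℝ :=
  Classical.epsilon fun lam : ℝ => ∀ t, spheroidalOp W T f t = -lam * f t

/-- The constant `C_extra = √(‖f'‖² - (lam / T) f(T)² / (1 - g))` of a `W T`-prolate `f` with
eigenvalue `g`, where `‖·‖` is the `L²` norm over the real line. -/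
def cExtra (W T g : ℝ) (f : ℝ → ℝ) : ℝ :=
  Real.sqrt ((∫ t, deriv f t ^ 2) - spheroidalEigenvalue W T f / T * (f T ^ 2 / (1 - g)))

/-- The dual prolate `ξ̃(w) = √(T / W) ξ(T w / W)`, which is a prolate with the roles of `W` and
`T` exchanged (frequency-concentrated on `[-W, W]`). -/
def dual (W T : ℝ) (f : ℝ → ℝ) (w : ℝ) : ℝ := Real.sqrt (T / W) * f (T / W * w)

/-- `ε̃_M = 2π ∑_{l < M} γ_l (1 - γ_l) C_{extra,l}`. The constant `C_{extra,l}` is that of the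
dual prolate, which is concentrated on `[-W, W]`: this is where `T` and `W` are exchanged. -/
def epsTilde (W T : ℝ) (γ : ℕ → ℝ) (ξ : ℕ → ℝ → ℝ) (M : ℕ) : ℝ :=
  2 * Real.pi * ∑ l ∈ Finset.range M, γ l * (1 - γ l) * cExtra T W (γ l) (dual W T (ξ l))

/-- The signal `C(t) = ∑_k |a_k|² e^{i ω_k t}`. -/
def signal {ι : Type*} (a : ι → ℂ) (ω : ι → ℝ) (t : ℝ) : ℂ :=
  ∑' k, ((‖a k‖ ^ 2 : ℝ) : ℂ) * Complex.exp (Complex.I * ω k * t)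

/-- The Gram matrix `V²_M` computed from a signal `C` with filter centre `ωs`. -/
def gramMatrix (T ωs : ℝ) (ξ : ℕ → ℝ → ℝ) (C : ℝ → ℂ) (M : ℕ) : Matrix (Fin M) (Fin M) ℂ :=
  Matrix.of fun s l => ∫ t in (-T)..T, ∫ τ in (-T)..T,
    Complex.exp (-Complex.I * ωs * (τ - t)) * ξ s τ * ξ l t * C (τ - t)

/-- The matrix `H_{V_M}` computed from a signal `C` with filter centre `ωs`; the derivative is
the one of `t ↦ C(τ - t)`. -/
def hamMatrix (T ωs : ℝ) (ξ : ℕ → ℝ → ℝ) (C : ℝ → ℂ) (M : ℕ) : Matrix (Fin M) (Fin M) ℂ :=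
  Matrix.of fun s l => Complex.I * ∫ t in (-T)..T, ∫ τ in (-T)..T,
    Complex.exp (-Complex.I * ωs * (τ - t)) * ξ s τ * ξ l t * deriv (fun u : ℝ => C (τ - u)) t

/-- `lam` lists the eigenvalues of `V2` in decreasing order, diagonalized by the unitary `U`. -/
def Diagonalizes {M : ℕ} (V2 U : Matrix (Fin M) (Fin M) ℂ) (lam : Fin M → ℝ) : Prop :=
  U ∈ Matrix.unitaryGroup (Fin M) ℂ ∧ Antitone lam ∧
    U.conjTranspose * V2 * U = Matrix.diagonal fun j => (lam j : ℂ)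

/-- The refined Gram matrix `diag(lam_1, …, lam_m)`. -/
def refinedGram {M m : ℕ} (h : m ≤ M) (lam : Fin M → ℝ) : Matrix (Fin m) (Fin m) ℂ :=
  Matrix.diagonal fun i => (lam (Fin.castLE h i) : ℂ)

/-- The refined matrix: the leading `m × m` block of `U† H U`. -/
def refinedHam {M m : ℕ} (h : m ≤ M) (U H : Matrix (Fin M) (Fin M) ℂ) :
    Matrix (Fin m) (Fin m) ℂ :=
  (U.conjTranspose * H * U).submatrix (Fin.castLE h) (Fin.castLE h)

/-- `μ` lists, with multiplicity and in decreasing order, the eigenvalues of the generalized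
eigenvalue problem `A x = μ B x`. -/
def IsGEPEigenvalues {m : ℕ} (A B : Matrix (Fin m) (Fin m) ℂ) (μ : Fin m → ℝ) : Prop :=
  Antitone μ ∧ ∃ Φ : Matrix (Fin m) (Fin m) ℂ, Φ.conjTranspose * B * Φ = 1 ∧
    A * Φ = B * Φ * Matrix.diagonal fun i => (μ i : ℂ)

end PFD

end

/-!
The finite Fourier transform on `[-T, T]` composed with its reflection is, up to a factor, the
integral operator with kernel `ρ_W`, and it commutes with the prolate differential operator. Its
eigenspaces are invariant under both and under reflection, and an eigenfunction vanishing at the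
endpoint `T` vanishes to all orders there, hence identically; so the eigenspaces are lines, and
every prolate has a parity, satisfies the differential equation and reproduces itself under the
finite Fourier transform. Plancherel and the differential equation at the endpoint express
`∫ f'²` over the complement of `[-T, T]` through `C_extra`, and Agmon's inequality on the half line
beyond `T` gives `f(s)² ≤ (1 - γ) C_extra` for `|s| ≥ T`.

Applied to the dual prolates, this bounds the filtered amplitudes `v_k` of the frequencies outside
the band by `‖v_k‖² ≤ ε̃_M`. The Gram matrix and the matrix `H` are the rank-one sums
`∑ |a_k|² v_k v_k†` and `∑ ω_k |a_k|² v_k v_k†`, and the refinement only replaces `v_k` by a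
projection of `v_k`. For the upper bound, some vector in the span of the first `i + 1` generalized
eigenvectors is orthogonal to the amplitudes of the `i` larger frequencies in the band; in its
Rayleigh quotient only the frequencies above the band can push `ω̃_i` beyond `ω_i`, and they do so
by their leakage. The lower bound is the upper bound for the reflected spectrum.
-/

noncomputable section

namespace PFD

open Complex Set Filter Topology
open scoped FourierTransform SchwartzMap

section FiniteFourierTransform

open scoped ContDiff

/-- The kernel `e^{iκst}` of the finite Fourier transform. -/
def expKernel (κ s t : ℝ) : ℂ := cexp ((κ * s * t : ℝ) * I)

variable {κ T : ℝ} {f g : ℝ → ℂ}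

lemma expKernel_comm (κ s t : ℝ) : expKernel κ s t = expKernel κ t s := by
  rw [expKernel, expKernel, mul_right_comm]

lemma expKernel_neg_left (κ s t : ℝ) : expKernel κ (-s) t = expKernel κ s (-t) := by
  rw [expKernel, expKernel, mul_neg, neg_mul, mul_neg]

lemma norm_expKernel (κ s t : ℝ) : ‖expKernel κ s t‖ = 1 := norm_exp_ofReal_mul_I _

@[fun_prop]
lemma continuous_expKernel (κ : ℝ) {X : Type*} [TopologicalSpace X] {u v : X → ℝ}
    (hu : Continuous u) (hv : Continuous v) : Continuous fun x => expKernel κ (u x) (v x) := by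
  unfold expKernel
  fun_prop

lemma hasDerivAt_expKernel (κ s t : ℝ) :
    HasDerivAt (expKernel κ s) (expKernel κ s t * (I * κ * s)) t := by
  have hlin : HasDerivAt (fun t : ℝ => κ * s * t) (κ * s) t := by
    simpa using (hasDerivAt_id t).const_mul (κ * s)
  convert! (hlin.ofReal_comp.mul_const I).cexp using 1
  simp only [expKernel]
  push_cast
  ring

lemma deriv_expKernel (κ s : ℝ) :
    deriv (expKernel κ s) = fun t => expKernel κ s t * (I * κ * s) :=
  funext fun t => (hasDerivAt_expKernel κ s t).deriv

lemma contDiff_expKernel (κ s : ℝ) {n : WithTop ℕ∞} : ContDiff ℝ n (expKernel κ s) :=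
  ((ofRealCLM.contDiff.comp (contDiff_const.mul contDiff_id)).mul contDiff_const).cexp

lemma intervalIntegrable_expKernel_mul (κ s : ℝ) {a b : ℝ}
    (hf : IntervalIntegrable f volume a b) :
    IntervalIntegrable (fun t => expKernel κ s t * f t) volume a b :=
  hf.continuousOn_mul (by fun_prop)

/-- The finite Fourier transform `f ↦ ∫_{-T}^{T} e^{iκst} f(t) dt`. -/
def finFourier (κ T : ℝ) (f : ℝ → ℂ) (s : ℝ) : ℂ :=
  ∫ t in (-T)..T, expKernel κ s t * f t

lemma hasDerivAt_finFourier (hf : IntervalIntegrable f volume (-T) T) (s : ℝ) :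
    HasDerivAt (finFourier κ T f) (finFourier κ T (fun t => I * κ * t * f t) s) s := by
  have hmul : IntervalIntegrable (fun t => I * κ * t * f t) volume (-T) T :=
    hf.continuousOn_mul (by fun_prop)
  refine (intervalIntegral.hasDerivAt_integral_of_dominated_loc_of_deriv_le
    (bound := fun t => ‖I * κ * t * f t‖) univ_mem
    (F' := fun s t => expKernel κ s t * (I * κ * t * f t))
    (Eventually.of_forall fun x =>
      (intervalIntegrable_expKernel_mul κ x hf).aestronglyMeasurable_restrict_uIoc)
    (intervalIntegrable_expKernel_mul κ s hf)
    (intervalIntegrable_expKernel_mul κ s hmul).aestronglyMeasurable_restrict_uIoc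
    (Eventually.of_forall fun t _ x _ => ?_) hmul.norm
    (Eventually.of_forall fun t _ x _ => ?_)).2
  · rw [norm_mul, norm_expKernel, one_mul]
  · simp_rw [expKernel_comm κ _ t, ← mul_assoc _ _ (f t)]
    exact (hasDerivAt_expKernel κ t x).mul_const (f t)

lemma continuous_finFourier (hf : IntervalIntegrable f volume (-T) T) :
    Continuous (finFourier κ T f) :=
  continuous_iff_continuousAt.2 fun s => (hasDerivAt_finFourier hf s).continuousAt

lemma deriv_finFourier (hf : IntervalIntegrable f volume (-T) T) :
    deriv (finFourier κ T f) = finFourier κ T (fun t => I * κ * t * f t) :=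
  funext fun s => (hasDerivAt_finFourier hf s).deriv

lemma iteratedDeriv_finFourier (hf : IntervalIntegrable f volume (-T) T) (n : ℕ) :
    iteratedDeriv n (finFourier κ T f) = finFourier κ T (fun t => (I * κ * t) ^ n * f t) := by
  induction n with
  | zero => simp
  | succ n ih =>
    rw [iteratedDeriv_succ, ih, deriv_finFourier (hf.continuousOn_mul (by fun_prop))]
    simp only [pow_succ', mul_assoc]

lemma contDiff_finFourier (hf : IntervalIntegrable f volume (-T) T) :
    ContDiff ℝ ∞ (finFourier κ T f) :=
  contDiff_of_differentiable_iteratedDeriv fun n _ => by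
    rw [iteratedDeriv_finFourier hf]
    exact fun s => (hasDerivAt_finFourier (hf.continuousOn_mul (by fun_prop)) s).differentiableAt

lemma finFourier_comp_neg (κ T : ℝ) (f : ℝ → ℂ) (s : ℝ) :
    finFourier κ T (fun t => f (-t)) s = finFourier κ T f (-s) := by
  simpa [finFourier, expKernel_neg_left] using
    intervalIntegral.integral_comp_neg (a := -T) (b := T) (fun t => expKernel κ (-s) t * f t)

lemma finFourier_const_mul (κ T : ℝ) (c : ℂ) (f : ℝ → ℂ) (s : ℝ) :
    finFourier κ T (fun t => c * f t) s = c * finFourier κ T f s := by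
  simp only [finFourier, mul_left_comm _ c, intervalIntegral.integral_const_mul]

lemma finFourier_sub (hf : IntervalIntegrable f volume (-T) T)
    (hg : IntervalIntegrable g volume (-T) T) (s : ℝ) :
    finFourier κ T (fun t => f t - g t) s = finFourier κ T f s - finFourier κ T g s := by
  simp only [finFourier, mul_sub]
  exact intervalIntegral.integral_sub (intervalIntegrable_expKernel_mul κ s hf)
    (intervalIntegrable_expKernel_mul κ s hg)

lemma norm_finFourier_le {C : ℝ} (hT : 0 ≤ T) (hf : ∀ t ∈ Icc (-T) T, ‖f t‖ ≤ C) (s : ℝ) :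
    ‖finFourier κ T f s‖ ≤ C * (2 * T) := by
  refine (intervalIntegral.norm_integral_le_of_norm_le_const (C := C) fun t ht => ?_).trans_eq ?_
  · rw [norm_mul, norm_expKernel, one_mul]
    rw [uIoc_of_le (by linarith)] at ht
    exact hf t (Ioc_subset_Icc_self ht)
  · rw [sub_neg_eq_add, ← two_mul, abs_of_nonneg (by positivity)]

lemma integral_finFourier_mul (hf : IntervalIntegrable f volume (-T) T)
    (hg : IntervalIntegrable g volume (-T) T) :
    ∫ s in (-T)..T, finFourier κ T f s * g s = ∫ s in (-T)..T, f s * finFourier κ T g s := by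
  simp only [finFourier, ← intervalIntegral.integral_mul_const,
    ← intervalIntegral.integral_const_mul]
  rw [intervalIntegral_intervalIntegral_swap]
  · congr 1 with t
    congr 1 with s
    rw [expKernel_comm]
    ring
  · rw [intervalIntegrable_iff] at hf hg
    rw [IntegrableOn, Measure.volume_eq_prod, ← Measure.prod_restrict]
    refine ((hg.mul_prod hf).bdd_mul (c := 1)
      (by fun_prop : Continuous fun p : ℝ × ℝ => expKernel κ p.1 p.2).aestronglyMeasurable
      (Eventually.of_forall fun p => (norm_expKernel κ p.1 p.2).le)).congr
      (Eventually.of_forall fun p => ?_)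
    simp only [Function.uncurry]
    ring

lemma finFourier_deriv (hf : ContDiff ℝ 1 f) (s : ℝ) :
    finFourier κ T (deriv f) s =
      expKernel κ s T * f T - expKernel κ s (-T) * f (-T) - I * κ * s * finFourier κ T f s := by
  have hparts := intervalIntegral.integral_mul_deriv_eq_deriv_mul (a := -T) (b := T)
    (fun t _ => hasDerivAt_expKernel κ s t)
    (fun t _ => (hf.differentiable one_ne_zero t).hasDerivAt)
    (Continuous.intervalIntegrable (by fun_prop) _ _)
    ((hf.continuous_deriv le_rfl).intervalIntegrable _ _)
  rw [finFourier, hparts, finFourier, ← intervalIntegral.integral_const_mul]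
  simp only [mul_comm, mul_left_comm]

end FiniteFourierTransform

section ProlateOperator

variable {κ T : ℝ} {f g : ℝ → ℂ}

/-- The prolate differential operator on complex-valued functions, with `W = κ T`. -/
def prolateOp (κ T : ℝ) (f : ℝ → ℂ) (t : ℝ) : ℂ :=
  (T ^ 2 - t ^ 2) * deriv (deriv f) t - 2 * t * deriv f t + (κ * T) ^ 2 * (T ^ 2 - t ^ 2) * f t

lemma continuous_prolateOp (hf : ContDiff ℝ 2 f) : Continuous (prolateOp κ T f) := by
  have hf' : ContDiff ℝ 1 (deriv f) := ((contDiff_succ_iff_deriv (n := 1)).1 hf).2.2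
  have hf0 : Continuous f := hf.continuous
  have hf1 : Continuous (deriv f) := hf'.continuous
  unfold prolateOp
  fun_prop

lemma prolateOp_comp_neg (κ T : ℝ) (f : ℝ → ℂ) (t : ℝ) :
    prolateOp κ T (fun u => f (-u)) t = prolateOp κ T f (-t) := by
  have hderiv : deriv (fun u => f (-u)) = fun u => -deriv f (-u) :=
    funext fun u => deriv_comp_neg f u
  simp only [prolateOp, hderiv, deriv.fun_neg, deriv_comp_neg]
  push_cast
  ring

lemma prolateOp_const_mul (κ T : ℝ) (c : ℂ) (f : ℝ → ℂ) (t : ℝ) :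
    prolateOp κ T (fun u => c * f u) t = c * prolateOp κ T f t := by
  simp only [prolateOp, deriv_const_mul_field']
  ring

lemma prolateOp_expKernel (κ T s t : ℝ) :
    prolateOp κ T (expKernel κ s) t =
      expKernel κ s t * (κ ^ 2 * (T ^ 2 - s ^ 2) * (T ^ 2 - t ^ 2) - 2 * I * κ * s * t) := by
  simp only [prolateOp, deriv_expKernel, deriv_mul_const_field']
  linear_combination expKernel κ s t * ((κ : ℂ) * s) ^ 2 * (T ^ 2 - t ^ 2) * I_sq

/-- `prolateOp f * g - f * prolateOp g` is the derivative of `(T² - t²) (f' g - f g')`, which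
vanishes at the endpoints. -/
lemma integral_prolateOp_mul (hf : ContDiff ℝ 2 f) (hg : ContDiff ℝ 2 g) :
    ∫ t in (-T)..T, prolateOp κ T f t * g t = ∫ t in (-T)..T, f t * prolateOp κ T g t := by
  have hf' : ContDiff ℝ 1 (deriv f) := ((contDiff_succ_iff_deriv (n := 1)).1 hf).2.2
  have hg' : ContDiff ℝ 1 (deriv g) := ((contDiff_succ_iff_deriv (n := 1)).1 hg).2.2
  have hfg : Continuous fun t => prolateOp κ T f t * g t :=
    (continuous_prolateOp hf).mul hg.continuous
  have hgf : Continuous fun t => f t * prolateOp κ T g t :=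
    hf.continuous.mul (continuous_prolateOp hg)
  have hwronskian : ∀ t : ℝ, HasDerivAt
      (fun t : ℝ => ((T : ℂ) ^ 2 - (t : ℂ) ^ 2) * (deriv f t * g t - f t * deriv g t))
      (prolateOp κ T f t * g t - f t * prolateOp κ T g t) t := by
    intro t
    have hd {h : ℝ → ℂ} (hh : ContDiff ℝ 1 h) : HasDerivAt h (deriv h t) t :=
      (hh.differentiable one_ne_zero t).hasDerivAt
    have hweight : HasDerivAt (fun t : ℝ => (T : ℂ) ^ 2 - (t : ℂ) ^ 2) (-(2 * t)) t := by
      simpa using ((hasDerivAt_id t).ofReal_comp.pow 2).const_sub ((T : ℂ) ^ 2)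
    have hf1 := hd (hf.of_le one_le_two)
    have hg1 := hd (hg.of_le one_le_two)
    convert! hweight.mul (((hd hf').mul hg1).sub (hf1.mul (hd hg'))) using 1
    simp only [prolateOp, Pi.mul_apply, Pi.sub_apply]
    ring
  rw [← sub_eq_zero, ← intervalIntegral.integral_sub (hfg.intervalIntegrable _ _)
    (hgf.intervalIntegrable _ _), intervalIntegral.integral_eq_sub_of_hasDerivAt
    (fun t _ => hwronskian t) ((hfg.sub hgf).intervalIntegrable _ _)]
  simp

lemma prolateOp_finFourier_eq_integral (hf : Continuous f) (s : ℝ) :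
    prolateOp κ T (finFourier κ T f) s =
      ∫ t in (-T)..T, prolateOp κ T (expKernel κ t) s * f t := by
  have hint {h : ℝ → ℂ} (hh : Continuous h) (c : ℂ) :
      IntervalIntegrable (fun t => c * (expKernel κ s t * h t)) volume (-T) T :=
    ((intervalIntegrable_expKernel_mul κ s (hh.intervalIntegrable _ _)).const_mul c)
  rw [prolateOp, deriv_finFourier (hf.intervalIntegrable _ _),
    deriv_finFourier (Continuous.intervalIntegrable (by fun_prop) _ _)]
  simp only [finFourier, ← intervalIntegral.integral_const_mul]
  rw [← intervalIntegral.integral_sub (hint (by fun_prop) _) (hint (by fun_prop) _),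
    ← intervalIntegral.integral_add ((hint (by fun_prop) _).sub (hint (by fun_prop) _))
      (hint hf _)]
  congr 1 with t
  rw [prolateOp_expKernel, expKernel_comm κ t s]
  linear_combination expKernel κ s t * ((κ : ℂ) * t) ^ 2 * (T ^ 2 - s ^ 2) * f t * I_sq

lemma prolateOp_finFourier (hf : ContDiff ℝ 2 f) (s : ℝ) :
    prolateOp κ T (finFourier κ T f) s = finFourier κ T (prolateOp κ T f) s := by
  have hsymm : ∀ t, prolateOp κ T (expKernel κ t) s = prolateOp κ T (expKernel κ s) t := by
    intro t
    rw [prolateOp_expKernel, prolateOp_expKernel, expKernel_comm]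
    ring
  simp only [prolateOp_finFourier_eq_integral hf.continuous, hsymm]
  exact integral_prolateOp_mul (contDiff_expKernel κ s) hf

end ProlateOperator

section Taylor

open scoped ContDiff

variable {E : Type*} [NormedAddCommGroup E] [NormedSpace ℝ E] {f : ℝ → E} {C K a : ℝ}

lemma eq_zero_of_iteratedDeriv_eq_zero_of_le (hf : ContDiff ℝ ∞ f)
    (hbound : ∀ n s, ‖iteratedDeriv n f s‖ ≤ C * K ^ n) (hzero : ∀ n, iteratedDeriv n f a = 0)
    {x : ℝ} (hx : a ≤ x) : f x = 0 := by
  rcases hx.eq_or_lt with rfl | hax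
  · simpa using hzero 0
  have hwithin : ∀ n, ∀ y ∈ Icc a x, iteratedDerivWithin n f (Icc a x) y = iteratedDeriv n f y :=
    fun n y hy => iteratedDerivWithin_eq_iteratedDeriv (uniqueDiffOn_Icc hax)
      (contDiff_infty.1 hf n).contDiffAt hy
  have hremainder (n : ℕ) : ‖f x‖ ≤ C * K * ((K * (x - a)) ^ n / n.factorial) * (x - a) := by
    have hTaylor : taylorWithinEval f n (Icc a x) a x = 0 := by
      rw [taylor_within_apply]
      refine Finset.sum_eq_zero fun k _ => ?_
      rw [hwithin k a (left_mem_Icc.2 hax.le), hzero, smul_zero]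
    have hle := taylor_mean_remainder_bound (n := n) hax.le
      (contDiff_infty.1 hf (n + 1)).contDiffOn (right_mem_Icc.2 hax.le)
      (fun y hy => (congrArg norm (hwithin (n + 1) y hy)).trans_le (hbound (n + 1) y))
    rw [hTaylor, sub_zero] at hle
    exact hle.trans_eq (by rw [mul_pow]; ring)
  have hlim : Tendsto (fun n : ℕ => C * K * ((K * (x - a)) ^ n / n.factorial) * (x - a))
      atTop (𝓝 (C * K * 0 * (x - a))) :=
    ((FloorSemiring.tendsto_pow_div_factorial_atTop _).const_mul _).mul_const _
  simpa using ge_of_tendsto' hlim hremainder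

lemma eq_zero_of_iteratedDeriv_eq_zero (hf : ContDiff ℝ ∞ f)
    (hbound : ∀ n s, ‖iteratedDeriv n f s‖ ≤ C * K ^ n) (hzero : ∀ n, iteratedDeriv n f a = 0) :
    f = 0 := by
  ext x
  rcases le_total a x with hx | hx
  · exact eq_zero_of_iteratedDeriv_eq_zero_of_le hf hbound hzero hx
  · have hiter : ∀ n s, iteratedDeriv n (fun u => f (-u)) s =
        (-1 : ℝ) ^ n • iteratedDeriv n f (-s) := fun n s => iteratedDeriv_comp_neg n f s
    simpa using eq_zero_of_iteratedDeriv_eq_zero_of_le (f := fun u => f (-u)) (C := C) (K := K)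
      (hf.comp contDiff_neg) (fun n s => by simpa [hiter, norm_smul] using hbound n (-s))
      (a := -a) (fun n => by simp [hiter, hzero]) (neg_le_neg hx)

end Taylor

/-- `f` is a continuous solution of `F F* f = ν f`, where `F` is the finite Fourier transform and
`F*` its reflection. -/
structure IsFourierEigen (κ T : ℝ) (ν : ℂ) (f : ℝ → ℂ) : Prop where
  cont : Continuous f
  eigen : ∀ s, finFourier κ T (fun u => finFourier κ T f (-u)) s = ν * f s

namespace IsFourierEigen

open scoped ContDiff

variable {κ T : ℝ} {ν : ℂ} {f g : ℝ → ℂ}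

lemma continuous_finFourier_neg (hf : IsFourierEigen κ T ν f) :
    Continuous fun u => finFourier κ T f (-u) :=
  (continuous_finFourier (hf.cont.intervalIntegrable _ _)).comp continuous_neg

lemma finFourier_finFourier_neg (hf : IsFourierEigen κ T ν f) :
    finFourier κ T (fun u => finFourier κ T f (-u)) = fun t => ν * f t :=
  funext hf.eigen

lemma eq_finFourier (hf : IsFourierEigen κ T ν f) (hν : ν ≠ 0) :
    f = finFourier κ T (fun u => ν⁻¹ * finFourier κ T f (-u)) := by
  ext s
  rw [finFourier_const_mul, hf.eigen, inv_mul_cancel_left₀ hν]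

lemma contDiff_infty (hf : IsFourierEigen κ T ν f) (hν : ν ≠ 0) : ContDiff ℝ ∞ f := by
  rw [hf.eq_finFourier hν]
  exact contDiff_finFourier
    ((hf.continuous_finFourier_neg.intervalIntegrable _ _).const_mul _)

lemma contDiff (hf : IsFourierEigen κ T ν f) (hν : ν ≠ 0) (n : ℕ) : ContDiff ℝ n f :=
  _root_.contDiff_infty.1 (hf.contDiff_infty hν) n

lemma hasDerivAt (hf : IsFourierEigen κ T ν f) (hν : ν ≠ 0) (t : ℝ) :
    HasDerivAt f (deriv f t) t :=
  ((hf.contDiff hν 1).differentiable one_ne_zero t).hasDerivAt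

lemma continuous_deriv (hf : IsFourierEigen κ T ν f) (hν : ν ≠ 0) : Continuous (deriv f) :=
  (hf.contDiff hν 1).continuous_deriv le_rfl

lemma const_mul (hf : IsFourierEigen κ T ν f) (c : ℂ) :
    IsFourierEigen κ T ν fun t => c * f t where
  cont := continuous_const.mul hf.cont
  eigen s := by
    simp only [finFourier_const_mul, hf.eigen]
    ring

lemma sub (hf : IsFourierEigen κ T ν f) (hg : IsFourierEigen κ T ν g) :
    IsFourierEigen κ T ν fun t => f t - g t where
  cont := hf.cont.sub hg.cont
  eigen s := by
    simp_rw [finFourier_sub (hf.cont.intervalIntegrable _ _) (hg.cont.intervalIntegrable _ _)]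
    rw [finFourier_sub (hf.continuous_finFourier_neg.intervalIntegrable _ _)
      (hg.continuous_finFourier_neg.intervalIntegrable _ _), hf.eigen, hg.eigen, mul_sub]

lemma comp_neg (hf : IsFourierEigen κ T ν f) : IsFourierEigen κ T ν fun t => f (-t) where
  cont := hf.cont.comp continuous_neg
  eigen s := by
    simp_rw [finFourier_comp_neg]
    rw [← hf.eigen (-s), ← finFourier_comp_neg]

protected lemma finFourier (hf : IsFourierEigen κ T ν f) :
    IsFourierEigen κ T ν (finFourier κ T f) where
  cont := continuous_finFourier (hf.cont.intervalIntegrable _ _)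
  eigen s := by
    simp_rw [← finFourier_comp_neg κ T (finFourier κ T f)]
    rw [hf.finFourier_finFourier_neg, finFourier_const_mul]

protected lemma prolateOp (hf : IsFourierEigen κ T ν f) (hν : ν ≠ 0) :
    IsFourierEigen κ T ν (prolateOp κ T f) where
  cont := continuous_prolateOp (hf.contDiff hν 2)
  eigen s := by
    have hsmooth : ContDiff ℝ 2 fun u => finFourier κ T f (-u) :=
      _root_.contDiff_infty.1
        ((contDiff_finFourier (hf.cont.intervalIntegrable _ _)).comp contDiff_neg) 2
    simp_rw [← prolateOp_finFourier (hf.contDiff hν 2), ← prolateOp_comp_neg]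
    rw [← prolateOp_finFourier hsmooth s, hf.finFourier_finFourier_neg, prolateOp_const_mul]

lemma const_mul_deriv (hf : IsFourierEigen κ T ν f) (t : ℝ) :
    ν * deriv f t = finFourier κ T (fun u => I * κ * u * finFourier κ T f (-u)) t := by
  rw [← deriv_finFourier (hf.continuous_finFourier_neg.intervalIntegrable _ _),
    hf.finFourier_finFourier_neg, deriv_const_mul_field]

lemma const_mul_integral_deriv_mul (hf : IsFourierEigen κ T ν f) (hg : Continuous g) :
    ν * ∫ t in (-T)..T, deriv f t * g t =
      ∫ u in (-T)..T, I * κ * u * finFourier κ T f (-u) * finFourier κ T g u := by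
  have hc := hf.continuous_finFourier_neg
  rw [← integral_finFourier_mul (Continuous.intervalIntegrable (by fun_prop) _ _)
    (hg.intervalIntegrable _ _), ← intervalIntegral.integral_const_mul]
  simp only [← mul_assoc, hf.const_mul_deriv]

lemma integral_deriv_mul (hν : ν ≠ 0) (hf : IsFourierEigen κ T ν f)
    (hg : IsFourierEigen κ T ν g) :
    ∫ t in (-T)..T, deriv f t * g t = -∫ t in (-T)..T, f t * deriv g t := by
  refine mul_left_cancel₀ hν ?_
  simp_rw [mul_comm (f _)]
  rw [mul_neg, hf.const_mul_integral_deriv_mul hg.cont, hg.const_mul_integral_deriv_mul hf.cont,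
    ← intervalIntegral.integral_neg]
  have hflip := intervalIntegral.integral_comp_neg (a := -T) (b := T)
    (fun u : ℝ => I * κ * u * finFourier κ T f (-u) * finFourier κ T g u)
  rw [neg_neg] at hflip
  rw [← hflip]
  congr 1 with u
  rw [neg_neg]
  push_cast
  ring

/-- `∫ (f g)'` over `[-T, T]` vanishes because `∫ f' g` is antisymmetric on an eigenspace. -/
lemma mul_endpoint_eq (hν : ν ≠ 0) (hf : IsFourierEigen κ T ν f)
    (hg : IsFourierEigen κ T ν g) : f T * g T = f (-T) * g (-T) := by
  have hftc := intervalIntegral.integral_mul_deriv_eq_deriv_mul (a := -T) (b := T)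
    (fun t _ => hf.hasDerivAt hν t) (fun t _ => hg.hasDerivAt hν t)
    ((hf.continuous_deriv hν).intervalIntegrable _ _)
    ((hg.continuous_deriv hν).intervalIntegrable _ _)
  rw [hf.integral_deriv_mul hν hg] at hftc
  linear_combination -hftc

lemma neg_endpoint_eq_zero (hν : ν ≠ 0) (hf : IsFourierEigen κ T ν f) (h0 : f T = 0) :
    f (-T) = 0 := by
  simpa [h0] using hf.mul_endpoint_eq hν hf

protected lemma deriv (hν : ν ≠ 0) (hf : IsFourierEigen κ T ν f) (h0 : f T = 0) :
    IsFourierEigen κ T ν (deriv f) where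
  cont := hf.continuous_deriv hν
  eigen s := by
    simp_rw [hf.const_mul_deriv, finFourier_deriv (hf.contDiff hν 1), h0,
      hf.neg_endpoint_eq_zero hν h0]
    congr 1 with u
    push_cast
    ring

/-- Both `f'` and `prolateOp f` lie in the eigenspace, so `mul_endpoint_eq` applies to the pairs
`(f', f')` and `(prolateOp f, f')`. At `±T` the latter is `∓2T f'(±T)²`, whence `f'(T)² = 0`. -/
lemma deriv_endpoint_eq_zero (hT : T ≠ 0) (hν : ν ≠ 0) (hf : IsFourierEigen κ T ν f)
    (h0 : f T = 0) : deriv f T = 0 := by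
  have hd := hf.deriv hν h0
  have hdd := hd.mul_endpoint_eq hν hd
  have hpd := (hf.prolateOp hν).mul_endpoint_eq hν hd
  simp only [prolateOp, h0, hf.neg_endpoint_eq_zero hν h0] at hpd
  push_cast at hpd
  have hsq : (T : ℂ) * (deriv f T * deriv f T) = 0 := by
    linear_combination -hpd / 4 + T / 2 * hdd
  simpa [hT] using hsq

lemma iteratedDeriv_endpoint_eq_zero (hT : T ≠ 0) (hν : ν ≠ 0) (hf : IsFourierEigen κ T ν f)
    (h0 : f T = 0) (n : ℕ) : iteratedDeriv n f T = 0 := by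
  induction n generalizing f with
  | zero => simpa using h0
  | succ n ih =>
    rw [iteratedDeriv_succ']
    exact ih (hf.deriv hν h0) (hf.deriv_endpoint_eq_zero hT hν h0)

lemma exists_norm_iteratedDeriv_le (hT : 0 ≤ T) (hν : ν ≠ 0) (hf : IsFourierEigen κ T ν f) :
    ∃ C, ∀ n s, ‖iteratedDeriv n f s‖ ≤ C * (|κ| * T) ^ n := by
  have hc : Continuous fun u => ν⁻¹ * finFourier κ T f (-u) :=
    continuous_const.mul hf.continuous_finFourier_neg
  obtain ⟨C, hC⟩ := (isCompact_Icc (a := -T) (b := T)).exists_bound_of_continuousOn hc.continuousOn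
  refine ⟨C * (2 * T), fun n s => ?_⟩
  rw [hf.eq_finFourier hν, iteratedDeriv_finFourier (hc.intervalIntegrable _ _)]
  refine (norm_finFourier_le hT (C := (|κ| * T) ^ n * C) (fun t ht => ?_) s).trans_eq (by ring)
  rw [norm_mul, norm_pow, norm_mul, norm_mul, norm_I, one_mul, norm_real, norm_real,
    Real.norm_eq_abs, Real.norm_eq_abs]
  gcongr
  · exact abs_le.2 ht
  · exact hC t ht

lemma eq_zero_of_endpoint_eq_zero (hT : 0 < T) (hν : ν ≠ 0) (hf : IsFourierEigen κ T ν f)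
    (h0 : f T = 0) : f = 0 := by
  obtain ⟨C, hC⟩ := hf.exists_norm_iteratedDeriv_le hT.le hν
  exact eq_zero_of_iteratedDeriv_eq_zero (hf.contDiff_infty hν) hC
    (hf.iteratedDeriv_endpoint_eq_zero hT.ne' hν h0)

lemma exists_eq_const_mul (hT : 0 < T) (hν : ν ≠ 0) (hf : IsFourierEigen κ T ν f)
    (hg : IsFourierEigen κ T ν g) (hg0 : g T ≠ 0) : ∃ c : ℂ, ∀ t, f t = c * g t := by
  have hdiff := (hf.sub (hg.const_mul (f T / g T))).eq_zero_of_endpoint_eq_zero hT hν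
    (by field_simp; ring)
  exact ⟨f T / g T, fun t => sub_eq_zero.1 (congrFun hdiff t)⟩

end IsFourierEigen

section Plancherel

lemma norm_toLp_sq {α E : Type*} [MeasurableSpace α] [NormedAddCommGroup E] {μ : Measure α}
    {u : α → E} (hu : MemLp u 2 μ) : ‖hu.toLp u‖ ^ 2 = ∫ x, ‖u x‖ ^ 2 ∂μ := by
  have hnonneg : 0 ≤ ∫ x, ‖u x‖ ^ 2 ∂μ := integral_nonneg fun x => sq_nonneg _
  rw [Lp.norm_toLp, hu.eLpNorm_eq_integral_rpow_norm two_ne_zero ENNReal.ofNat_ne_top]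
  simp only [ENNReal.toReal_ofNat, Real.rpow_two]
  rw [ENNReal.toReal_ofReal (by positivity), ← Real.rpow_mul_natCast hnonneg]
  norm_num

variable {V E : Type*} [NormedAddCommGroup V] [InnerProductSpace ℝ V] [FiniteDimensional ℝ V]
  [MeasurableSpace V] [BorelSpace V] [NormedAddCommGroup E] [InnerProductSpace ℂ E]
  [CompleteSpace E] {h : V → E}

lemma integral_schwartz_smul_fourier (G : 𝓢(V, ℂ)) (hint : Integrable h) :
    ∫ x, (𝓕 G) x • h x = ∫ x, G x • 𝓕 h x := by
  have hflip := VectorFourier.integral_fourierIntegral_smul_eq_flip (L := innerₗ V)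
    Real.continuous_fourierChar continuous_inner (G.integrable (μ := volume)) hint
  rwa [flip_innerₗ] at hflip

/-- The `L²` Fourier transform is the distributional one, so it agrees with the Fourier integral
when paired with test functions. -/
lemma fourier_toLp_ae_eq (hint : Integrable h) (hL2 : MemLp h 2) :
    (𝓕 (hL2.toLp h) : Lp E 2 (volume : Measure V)) =ᵐ[volume] 𝓕 h := by
  have hcont : Continuous (𝓕 h) := VectorFourier.fourierIntegral_continuous
    Real.continuous_fourierChar continuous_inner hint
  refine ae_eq_of_integral_contDiff_smul_eq ((Lp.memLp _).locallyIntegrable one_le_two)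
    hcont.locallyIntegrable fun g g_diff g_supp => ?_
  let G : 𝓢(V, ℂ) := (g_supp.comp_left ofReal_zero : HasCompactSupport fun x => (g x : ℂ))
    |>.toSchwartzMap (ofRealCLM.contDiff.comp g_diff)
  have hdistr : Lp.toTemperedDistribution (𝓕 (hL2.toLp h) : Lp E 2 (volume : Measure V)) G =
      Lp.toTemperedDistribution (hL2.toLp h) (𝓕 G) := by
    rw [← Lp.fourier_toTemperedDistribution_eq]
    rfl
  rw [Lp.toTemperedDistribution_apply, Lp.toTemperedDistribution_apply] at hdistr
  calc ∫ x, g x • (𝓕 (hL2.toLp h) : Lp E 2 (volume : Measure V)) x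
    _ = ∫ x, G x • (𝓕 (hL2.toLp h) : Lp E 2 (volume : Measure V)) x := by congr 1
    _ = ∫ x, (𝓕 G) x • (hL2.toLp h) x := hdistr
    _ = ∫ x, (𝓕 G) x • h x := integral_congr_ae (hL2.coeFn_toLp.mono fun x hx => by simp only [hx])
    _ = ∫ x, G x • 𝓕 h x := integral_schwartz_smul_fourier G hint
    _ = ∫ x, g x • 𝓕 h x := by congr 1

lemma memLp_fourier (hint : Integrable h) (hL2 : MemLp h 2) : MemLp (𝓕 h) 2 :=
  (memLp_congr_ae (fourier_toLp_ae_eq hint hL2)).1 (Lp.memLp _)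

lemma integral_norm_fourier_sq (hint : Integrable h) (hL2 : MemLp h 2) :
    ∫ x, ‖𝓕 h x‖ ^ 2 = ∫ x, ‖h x‖ ^ 2 := by
  have hF := memLp_fourier hint hL2
  have htoLp : hF.toLp (𝓕 h) = 𝓕 (hL2.toLp h) := by
    rw [← Lp.toLp_coeFn (𝓕 (hL2.toLp h)) (Lp.memLp _)]
    exact (MemLp.toLp_eq_toLp_iff _ _).2 (fourier_toLp_ae_eq hint hL2).symm
  rw [← norm_toLp_sq hF, ← norm_toLp_sq hL2, htoLp, Lp.norm_fourier_eq]

end Plancherel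

section FiniteFourierPlancherel

variable {κ T : ℝ} {f : ℝ → ℂ}

lemma finFourier_eq_fourier (κ : ℝ) (hT : 0 ≤ T) (f : ℝ → ℂ) (s : ℝ) :
    finFourier κ T f s = 𝓕 ((Ioc (-T) T).indicator f) (-(κ / (2 * Real.pi)) * s) := by
  rw [Real.fourier_real_eq_integral_exp_smul, finFourier,
    intervalIntegral.integral_of_le (by linarith), ← integral_indicator measurableSet_Ioc]
  congr 1 with t
  by_cases ht : t ∈ Ioc (-T) T
  · simp only [indicator_of_mem ht, smul_eq_mul, expKernel]
    congr 4
    field_simp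
  · simp only [indicator_of_notMem ht, smul_zero]

lemma integrable_indicator_of_memLp (hf : MemLp f 2 (volume.restrict (Ioc (-T) T))) :
    Integrable ((Ioc (-T) T).indicator f) :=
  (integrable_indicator_iff measurableSet_Ioc).2 (hf.integrable one_le_two)

lemma neg_div_two_pi_ne_zero (hκ : κ ≠ 0) : -(κ / (2 * Real.pi)) ≠ 0 :=
  neg_ne_zero.2 (div_ne_zero hκ Real.two_pi_pos.ne')

lemma memLp_finFourier (hκ : κ ≠ 0) (hT : 0 ≤ T)
    (hf : MemLp f 2 (volume.restrict (Ioc (-T) T))) : MemLp (finFourier κ T f) 2 := by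
  have hint : IntervalIntegrable f volume (-T) T :=
    (intervalIntegrable_iff_integrableOn_Ioc_of_le (by linarith)).2 (hf.integrable one_le_two)
  have hF := memLp_fourier (integrable_indicator_of_memLp hf)
    ((memLp_indicator_iff_restrict measurableSet_Ioc).2 hf)
  refine (memLp_two_iff_integrable_sq_norm (continuous_finFourier hint).aestronglyMeasurable).2 ?_
  simp only [finFourier_eq_fourier κ hT]
  exact ((memLp_two_iff_integrable_sq_norm hF.1).1 hF).comp_mul_left' (neg_div_two_pi_ne_zero hκ)

lemma integral_norm_finFourier_sq (hκ : 0 < κ) (hT : 0 ≤ T)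
    (hf : MemLp f 2 (volume.restrict (Ioc (-T) T))) :
    ∫ s, ‖finFourier κ T f s‖ ^ 2 = 2 * Real.pi / κ * ∫ t in (-T)..T, ‖f t‖ ^ 2 := by
  simp only [finFourier_eq_fourier κ hT]
  rw [Measure.integral_comp_mul_left (fun y => ‖𝓕 ((Ioc (-T) T).indicator f) y‖ ^ 2),
    integral_norm_fourier_sq (integrable_indicator_of_memLp hf)
      ((memLp_indicator_iff_restrict measurableSet_Ioc).2 hf), abs_inv, abs_neg,
    abs_of_pos (div_pos hκ Real.two_pi_pos), inv_div, smul_eq_mul,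
    intervalIntegral.integral_of_le (by linarith), ← integral_indicator measurableSet_Ioc]
  congr 2 with t
  by_cases ht : t ∈ Ioc (-T) T <;> simp [ht]

end FiniteFourierPlancherel

section KernelSquare

variable {κ T : ℝ} {f : ℝ → ℂ}

lemma rho_neg (W x : ℝ) : rho W (-x) = rho W x := by
  rw [rho, rho, mul_neg, Real.sinc_neg]

lemma finFourier_one (hκ : κ ≠ 0) (T x : ℝ) :
    finFourier κ T (fun _ => 1) x = ((2 * Real.pi / κ * rho (κ * T) x : ℝ) : ℂ) := by
  rcases eq_or_ne x 0 with rfl | hx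
  · have hκ' : (κ : ℂ) ≠ 0 := ofReal_ne_zero.2 hκ
    simp only [finFourier, expKernel, rho, mul_zero, zero_mul, ofReal_zero, exp_zero, mul_one,
      intervalIntegral.integral_const, sub_neg_eq_add, real_smul, ofReal_add, Real.sinc_zero,
      ofReal_mul, ofReal_div, ofReal_ofNat]
    field_simp
    ring
  have hκx : κ * x ≠ 0 := mul_ne_zero hκ hx
  calc finFourier κ T (fun _ => 1) x = ∫ t in (-T)..T, cexp ((κ * x * t : ℝ) * I) := by
        simp only [finFourier, expKernel, mul_one]
    _ = (κ * x)⁻¹ • ∫ t in -(κ * x * T)..κ * x * T, cexp (t * I) := by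
        rw [intervalIntegral.integral_comp_mul_left (fun t : ℝ => cexp (t * I)) hκx, mul_neg]
    _ = _ := by
        rw [integral_exp_mul_I_eq_sinc, rho, mul_right_comm κ x T, real_smul]
        norm_cast
        field_simp

lemma finFourier_finFourier_neg (hκ : κ ≠ 0) (hf : IntervalIntegrable f volume (-T) T) (s : ℝ) :
    finFourier κ T (fun u => finFourier κ T f (-u)) s =
      (2 * Real.pi / κ : ℝ) * ∫ t in (-T)..T, (rho (κ * T) (s - t) : ℂ) * f t := by
  have hkernel : ∀ t, finFourier κ T (fun u => expKernel κ (-s) u) t =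
      (2 * Real.pi / κ : ℝ) * (rho (κ * T) (s - t) : ℂ) := by
    intro t
    rw [← ofReal_mul, ← rho_neg, neg_sub, ← finFourier_one hκ]
    refine intervalIntegral.integral_congr fun u _ => ?_
    simp only [expKernel, mul_one, ← Complex.exp_add]
    push_cast
    ring_nf
  calc finFourier κ T (fun u => finFourier κ T f (-u)) s
    _ = ∫ u in (-T)..T, finFourier κ T f u * expKernel κ (-s) u := by
        rw [finFourier_comp_neg, finFourier]
        simp only [mul_comm]
    _ = ∫ t in (-T)..T, f t * finFourier κ T (fun u => expKernel κ (-s) u) t :=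
        integral_finFourier_mul hf (Continuous.intervalIntegrable (by fun_prop) _ _)
    _ = _ := by
        rw [← intervalIntegral.integral_const_mul]
        simp only [hkernel, mul_comm, mul_left_comm]

end KernelSquare

section HalfLine

variable {F f f' : ℝ → ℝ} {s : ℝ}

lemma integral_eq_interval_add_two_mul_Ioi (hF : Integrable F) (heven : ∀ t, F (-t) = F t)
    (T : ℝ) : ∫ t, F t = (∫ t in (-T)..T, F t) + 2 * ∫ t in Ioi T, F t := by
  have hsub := intervalIntegral.integral_Iic_sub_Iic (a := -T) (b := T)
    hF.integrableOn hF.integrableOn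
  have hadd := intervalIntegral.integral_Iic_add_Ioi (b := T) hF.integrableOn hF.integrableOn
  have hreflect : ∫ t in Ioi T, F (-t) = ∫ t in Iic (-T), F t := integral_comp_neg_Ioi T F
  simp only [heven] at hreflect
  linarith

/-- Agmon's inequality: `f(s)² = -∫_s^∞ 2 f f'`, then Cauchy–Schwarz. -/
lemma sq_le_two_mul_sqrt_mul_sqrt (hd : ∀ t ∈ Ici s, HasDerivAt f (f' t) t)
    (hf : MemLp f 2 (volume.restrict (Ioi s))) (hf' : MemLp f' 2 (volume.restrict (Ioi s))) :
    f s ^ 2 ≤ 2 * (√(∫ t in Ioi s, f t ^ 2) * √(∫ t in Ioi s, f' t ^ 2)) := by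
  have hd2 : ∀ t ∈ Ici s, HasDerivAt (fun t => f t ^ 2) (2 * (f t * f' t)) t := fun t ht => by
    convert! (hd t ht).pow 2 using 1
    simp [mul_assoc]
  have hint : IntegrableOn (fun t => 2 * (f t * f' t)) (Ioi s) :=
    (hf.integrable_mul hf').const_mul 2
  have hlim := tendsto_zero_of_hasDerivAt_of_integrableOn_Ioi
    (fun t ht => hd2 t (Ioi_subset_Ici_self ht)) hint hf.integrable_sq
  have hftc := integral_Ioi_of_hasDerivAt_of_tendsto' hd2 hint hlim
  have hcs := integral_mul_norm_le_Lp_mul_Lq (μ := volume.restrict (Ioi s)) (f := f) (g := f')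
    Real.HolderConjugate.two_two (by simpa using hf) (by simpa using hf')
  simp only [Real.norm_eq_abs, Real.rpow_two, sq_abs, ← Real.sqrt_eq_rpow] at hcs
  calc f s ^ 2 = -∫ t in Ioi s, 2 * (f t * f' t) := by rw [hftc, zero_sub, neg_neg]
    _ ≤ ∫ t in Ioi s, |2 * (f t * f' t)| := (neg_le_abs _).trans abs_integral_le_integral_abs
    _ = 2 * ∫ t in Ioi s, |f t| * |f' t| := by
        simp only [abs_mul, Nat.abs_ofNat, integral_const_mul]
    _ ≤ _ := by gcongr

end HalfLine

section RealValued

lemma conj_finFourier_ofReal (κ T : ℝ) (f : ℝ → ℝ) (s : ℝ) :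
    (starRingEnd ℂ) (finFourier κ T (fun t => (f t : ℂ)) s) =
      finFourier κ T (fun t => (f t : ℂ)) (-s) := by
  have hconj : ∀ t, (starRingEnd ℂ) (expKernel κ s t * f t) = expKernel κ (-s) t * f t := by
    intro t
    simp only [expKernel, map_mul, ← exp_conj, conj_ofReal, conj_I]
    push_cast
    ring_nf
  simp only [finFourier, intervalIntegral, map_sub, ← integral_conj, hconj]

lemma iteratedDeriv_ofReal_comp {f : ℝ → ℝ} {n : ℕ} (hf : ContDiff ℝ n f) :
    iteratedDeriv n (fun t => (f t : ℂ)) = fun t => ((iteratedDeriv n f t : ℝ) : ℂ) := by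
  induction n with
  | zero => simp
  | succ n ih =>
    have hdiff := hf.differentiable_iteratedDeriv n (by exact_mod_cast n.lt_succ_self)
    rw [iteratedDeriv_succ, iteratedDeriv_succ,
      ih (hf.of_le (by exact_mod_cast n.le_succ))]
    exact funext fun t => (hdiff t).hasDerivAt.ofReal_comp.deriv

lemma prolateOp_ofReal_comp {f : ℝ → ℝ} (hf : ContDiff ℝ 2 f) (κ T t : ℝ) :
    prolateOp κ T (fun t => (f t : ℂ)) t = (spheroidalOp (κ * T) T f t : ℂ) := by
  have h1 := iteratedDeriv_ofReal_comp (n := 1) (hf.of_le one_le_two)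
  have h2 := iteratedDeriv_ofReal_comp (n := 2) hf
  rw [iteratedDeriv_one, iteratedDeriv_one] at h1
  simp only [iteratedDeriv_succ, iteratedDeriv_zero, h1] at h2
  simp only [prolateOp, spheroidalOp, h1, h2]
  push_cast
  ring

end RealValued

/-- A normalized prolate function `f` of bandwidth `W` concentrated on `[-T, T]`, with
eigenvalue `g`. -/
structure IsProlate (W T g : ℝ) (f : ℝ → ℝ) : Prop where
  memLp : MemLp f 2 volume
  eigen : ∀ s, ∫ t in (-T)..T, rho W (s - t) * f t = g * f s
  pos : 0 < g
  norm_one : ∫ t, f t ^ 2 = 1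

lemma IsProlateSequence.isProlate {W T : ℝ} {γ : ℕ → ℝ} {ξ : ℕ → ℝ → ℝ}
    (h : IsProlateSequence W T γ ξ) (n : ℕ) : IsProlate W T (γ n) (ξ n) where
  memLp := h.memLp n
  eigen := h.eigen n
  pos := h.pos n
  norm_one := by simpa [sq] using h.orthonormal n n

namespace IsProlate

variable {W T g : ℝ} {f : ℝ → ℝ}

lemma intervalIntegrable (h : IsProlate W T g f) (a b : ℝ) : IntervalIntegrable f volume a b :=
  ((h.memLp.locallyIntegrable one_le_two).integrableOn_isCompact
    isCompact_uIcc).intervalIntegrable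

lemma intervalIntegrable_ofReal (h : IsProlate W T g f) (a b : ℝ) :
    IntervalIntegrable (fun t => (f t : ℂ)) volume a b :=
  ⟨(h.intervalIntegrable a b).1.ofReal, (h.intervalIntegrable a b).2.ofReal⟩

lemma finFourier_finFourier_neg (hW : 0 < W) (hT : 0 < T) (h : IsProlate W T g f) (s : ℝ) :
    finFourier (W / T) T (fun u => finFourier (W / T) T (fun t => (f t : ℂ)) (-u)) s =
      (2 * Real.pi * g / (W / T) : ℝ) * (f s : ℂ) := by
  have heigen : ∫ t in (-T)..T, (rho W (s - t) : ℂ) * (f t : ℂ) = ((g * f s : ℝ) : ℂ) := by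
    simp only [← h.eigen s, ← intervalIntegral.integral_ofReal, ofReal_mul]
  rw [PFD.finFourier_finFourier_neg (div_pos hW hT).ne' (h.intervalIntegrable_ofReal _ _),
    div_mul_cancel₀ W hT.ne', heigen]
  push_cast
  ring

lemma fourierEigenvalue_pos (hW : 0 < W) (hT : 0 < T) (h : IsProlate W T g f) :
    0 < 2 * Real.pi * g / (W / T) :=
  div_pos (mul_pos Real.two_pi_pos h.pos) (div_pos hW hT)

lemma fourierEigenvalue_ne_zero (hW : 0 < W) (hT : 0 < T) (h : IsProlate W T g f) :
    ((2 * Real.pi * g / (W / T) : ℝ) : ℂ) ≠ 0 :=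
  ofReal_ne_zero.2 (h.fourierEigenvalue_pos hW hT).ne'

lemma isFourierEigen (hW : 0 < W) (hT : 0 < T) (h : IsProlate W T g f) :
    IsFourierEigen (W / T) T (2 * Real.pi * g / (W / T) : ℝ) (fun t => (f t : ℂ)) where
  eigen := h.finFourier_finFourier_neg hW hT
  cont := by
    have hFf := continuous_finFourier (κ := W / T)
      (h.intervalIntegrable_ofReal (-T) T)
    have hscaled := (continuous_finFourier (κ := W / T) (T := T)
      ((hFf.comp continuous_neg).intervalIntegrable _ _)).const_mul
      ((2 * Real.pi * g / (W / T) : ℝ) : ℂ)⁻¹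
    simpa only [Function.comp_def, h.finFourier_finFourier_neg hW hT,
      inv_mul_cancel_left₀ (h.fourierEigenvalue_ne_zero hW hT)] using hscaled

lemma contDiff (hW : 0 < W) (hT : 0 < T) (h : IsProlate W T g f) (n : ℕ) : ContDiff ℝ n f :=
  reCLM.contDiff.comp
    ((h.isFourierEigen hW hT).contDiff (h.fourierEigenvalue_ne_zero hW hT) n)

lemma hasDerivAt (hW : 0 < W) (hT : 0 < T) (h : IsProlate W T g f) (t : ℝ) :
    HasDerivAt f (deriv f t) t :=
  ((h.contDiff hW hT 1).differentiable one_ne_zero t).hasDerivAt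

lemma endpoint_ne_zero (hW : 0 < W) (hT : 0 < T) (h : IsProlate W T g f) : f T ≠ 0 := by
  intro h0
  have hzero := (h.isFourierEigen hW hT).eq_zero_of_endpoint_eq_zero hT
    (h.fourierEigenvalue_ne_zero hW hT) (ofReal_eq_zero.2 h0)
  have hf : ∀ t, f t = 0 := fun t => ofReal_eq_zero.1 (congrFun hzero t)
  simpa [hf] using h.norm_one

lemma exists_eq_const_mul (hW : 0 < W) (hT : 0 < T) (h : IsProlate W T g f) {u : ℝ → ℂ}
    (hu : IsFourierEigen (W / T) T (2 * Real.pi * g / (W / T) : ℝ) u) :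
    ∃ c : ℂ, ∀ t, u t = c * f t :=
  hu.exists_eq_const_mul hT (h.fourierEigenvalue_ne_zero hW hT) (h.isFourierEigen hW hT)
    (ofReal_ne_zero.2 (h.endpoint_ne_zero hW hT))

lemma exists_finFourier_eq (hW : 0 < W) (hT : 0 < T) (h : IsProlate W T g f) :
    ∃ μ : ℂ, ‖μ‖ ^ 2 = 2 * Real.pi * g / (W / T) ∧
      ∀ s, finFourier (W / T) T (fun t => (f t : ℂ)) s = μ * f s := by
  obtain ⟨μ, hμ⟩ := h.exists_eq_const_mul hW hT (h.isFourierEigen hW hT).finFourier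
  have hconj : ∀ u, finFourier (W / T) T (fun t => (f t : ℂ)) (-u) =
      (starRingEnd ℂ) μ * f u := fun u => by
    rw [← conj_finFourier_ofReal, hμ, map_mul, conj_ofReal]
  have heigen := h.finFourier_finFourier_neg hW hT T
  simp only [hconj] at heigen
  rw [finFourier_const_mul, hμ, ← mul_assoc] at heigen
  have hnormSq := mul_right_cancel₀ (ofReal_ne_zero.2 (h.endpoint_ne_zero hW hT)) heigen
  rw [mul_comm, mul_conj, normSq_eq_norm_sq] at hnormSq
  exact ⟨μ, ofReal_injective hnormSq, hμ⟩

lemma exists_finFourier_pow_mul_eq (hW : 0 < W) (hT : 0 < T) (h : IsProlate W T g f) :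
    ∃ μ : ℂ, μ ≠ 0 ∧ ‖μ‖ ^ 2 = 2 * Real.pi * g / (W / T) ∧ ∀ (n : ℕ) (s : ℝ),
      finFourier (W / T) T (fun t => (I * (W / T : ℝ) * t) ^ n * f t) s =
        μ * (iteratedDeriv n f s : ℝ) := by
  obtain ⟨μ, hμnorm, hμ⟩ := h.exists_finFourier_eq hW hT
  have hμ0 : μ ≠ 0 := by
    rintro rfl
    exact (h.fourierEigenvalue_pos hW hT).ne (by simpa using hμnorm)
  refine ⟨μ, hμ0, hμnorm, fun n s => ?_⟩
  rw [← iteratedDeriv_finFourier (h.intervalIntegrable_ofReal (-T) T), funext hμ,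
    iteratedDeriv_const_mul_field, iteratedDeriv_ofReal_comp (h.contDiff hW hT n)]

lemma exists_parity (hW : 0 < W) (hT : 0 < T) (h : IsProlate W T g f) :
    ∃ ε : ℝ, ε ^ 2 = 1 ∧ ∀ t, f (-t) = ε * f t := by
  obtain ⟨c, hc⟩ := h.exists_eq_const_mul hW hT (h.isFourierEigen hW hT).comp_neg
  have hre : ∀ t, f (-t) = c.re * f t := fun t => by simpa using congrArg re (hc t)
  refine ⟨c.re, mul_right_cancel₀ (h.endpoint_ne_zero hW hT) ?_, hre⟩
  rw [sq, mul_assoc, ← hre, ← hre, neg_neg, one_mul]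

lemma sq_neg (hW : 0 < W) (hT : 0 < T) (h : IsProlate W T g f) (t : ℝ) :
    f (-t) ^ 2 = f t ^ 2 := by
  obtain ⟨ε, hε, hf⟩ := h.exists_parity hW hT
  rw [hf, mul_pow, hε, one_mul]

lemma deriv_sq_neg (hW : 0 < W) (hT : 0 < T) (h : IsProlate W T g f) (t : ℝ) :
    deriv f (-t) ^ 2 = deriv f t ^ 2 := by
  obtain ⟨ε, hε, hf⟩ := h.exists_parity hW hT
  have hderiv : -deriv f (-t) = ε * deriv f t := by
    rw [← deriv_comp_neg, funext hf, deriv_const_mul_field]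
  rw [← neg_sq, hderiv, mul_pow, hε, one_mul]

lemma exists_spheroidalOp_eq (hW : 0 < W) (hT : 0 < T) (h : IsProlate W T g f) :
    ∃ lam : ℝ, ∀ t, spheroidalOp W T f t = -lam * f t := by
  obtain ⟨c, hc⟩ := h.exists_eq_const_mul hW hT
    ((h.isFourierEigen hW hT).prolateOp (h.fourierEigenvalue_ne_zero hW hT))
  refine ⟨-c.re, fun t => ?_⟩
  have ht := congrArg re (hc t)
  rw [prolateOp_ofReal_comp (h.contDiff hW hT 2), div_mul_cancel₀ W hT.ne'] at ht
  simpa using ht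

lemma spheroidalOp_eq (hW : 0 < W) (hT : 0 < T) (h : IsProlate W T g f) (t : ℝ) :
    spheroidalOp W T f t = -spheroidalEigenvalue W T f * f t :=
  Classical.epsilon_spec (h.exists_spheroidalOp_eq hW hT) t

lemma mul_deriv_endpoint_eq (hW : 0 < W) (hT : 0 < T) (h : IsProlate W T g f) :
    f T * deriv f T = spheroidalEigenvalue W T f / (2 * T) * f T ^ 2 := by
  have hode := h.spheroidalOp_eq hW hT T
  simp only [spheroidalOp] at hode
  field_simp
  linear_combination (-f T) * hode

lemma mul_deriv_neg_endpoint_eq (hW : 0 < W) (hT : 0 < T) (h : IsProlate W T g f) :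
    f (-T) * deriv f (-T) = -(spheroidalEigenvalue W T f / (2 * T) * f T ^ 2) := by
  have hode := h.spheroidalOp_eq hW hT (-T)
  simp only [spheroidalOp] at hode
  rw [← h.sq_neg hW hT T]
  field_simp
  linear_combination f (-T) * hode

lemma memLp_pow_mul (hW : 0 < W) (hT : 0 < T) (h : IsProlate W T g f) (n : ℕ) :
    MemLp (fun t => (I * (W / T : ℝ) * t) ^ n * (f t : ℂ)) 2 (volume.restrict (Ioc (-T) T)) := by
  have hcont : Continuous fun t => (I * (W / T : ℝ) * t) ^ n * (f t : ℂ) := by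
    have hf := (h.contDiff hW hT 0).continuous
    fun_prop
  exact (memLp_two_iff_integrable_sq_norm hcont.aestronglyMeasurable).2
    (hcont.norm.pow 2).integrableOn_Ioc

lemma memLp_iteratedDeriv (hW : 0 < W) (hT : 0 < T) (h : IsProlate W T g f) (n : ℕ) :
    MemLp (iteratedDeriv n f) 2 volume := by
  obtain ⟨μ, hμ0, -, hμ⟩ := h.exists_finFourier_pow_mul_eq hW hT
  have hmem := memLp_finFourier (div_pos hW hT).ne' hT.le (h.memLp_pow_mul hW hT n)
  simp only [funext (hμ n)] at hmem
  simpa [hμ0] using (hmem.const_mul μ⁻¹).re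

lemma integral_iteratedDeriv_sq (hW : 0 < W) (hT : 0 < T) (h : IsProlate W T g f) (n : ℕ) :
    g * ∫ t, iteratedDeriv n f t ^ 2 = ∫ t in (-T)..T, ((W / T * t) ^ n * f t) ^ 2 := by
  obtain ⟨μ, -, hμnorm, hμ⟩ := h.exists_finFourier_pow_mul_eq hW hT
  have hnorm : ∀ t : ℝ, ‖(I * (W / T : ℝ) * t) ^ n * (f t : ℂ)‖ ^ 2 =
      ((W / T * t) ^ n * f t) ^ 2 := fun t => by
    rw [norm_mul, norm_pow, norm_mul, norm_mul, norm_I, one_mul, norm_real, norm_real, norm_real,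
      ← norm_mul, ← norm_pow, ← norm_mul, Real.norm_eq_abs, sq_abs]
  have hderiv : ∀ s, ‖μ * (iteratedDeriv n f s : ℝ)‖ ^ 2 =
      2 * Real.pi * g / (W / T) * iteratedDeriv n f s ^ 2 := fun s => by
    rw [norm_mul, mul_pow, hμnorm, norm_real, Real.norm_eq_abs, sq_abs]
  have hplancherel := integral_norm_finFourier_sq (div_pos hW hT) hT.le (h.memLp_pow_mul hW hT n)
  simp only [hnorm, hμ, hderiv, integral_const_mul] at hplancherel
  refine mul_left_cancel₀ (div_pos Real.two_pi_pos (div_pos hW hT)).ne' ?_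
  rw [← mul_assoc, div_mul_eq_mul_div, hplancherel]

lemma integral_sq (hW : 0 < W) (hT : 0 < T) (h : IsProlate W T g f) :
    ∫ t in (-T)..T, f t ^ 2 = g := by
  simpa [h.norm_one] using (h.integral_iteratedDeriv_sq hW hT 0).symm

lemma integral_mul_deriv_deriv (hW : 0 < W) (hT : 0 < T) (h : IsProlate W T g f) :
    ∫ t in (-T)..T, f t * deriv (deriv f) t = -∫ t in (-T)..T, (W / T * t * f t) ^ 2 := by
  obtain ⟨μ, hμ0, -, hμ⟩ := h.exists_finFourier_pow_mul_eq hW hT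
  have hf := (h.contDiff hW hT 0).continuous
  have hswap := integral_finFourier_mul (κ := W / T) (T := T)
    (f := fun t => (I * (W / T : ℝ) * t) ^ 2 * (f t : ℂ)) (g := fun t => (f t : ℂ))
    (Continuous.intervalIntegrable (by fun_prop) _ _) (h.intervalIntegrable_ofReal _ _)
  have hμ1 : ∀ s, finFourier (W / T) T (fun t => (f t : ℂ)) s = μ * f s := by simpa using hμ 0
  simp only [hμ, hμ1, iteratedDeriv_succ, iteratedDeriv_zero] at hswap
  refine ofReal_injective (mul_left_cancel₀ hμ0 ?_)
  rw [ofReal_neg, ← intervalIntegral.integral_ofReal, ← intervalIntegral.integral_ofReal,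
    ← intervalIntegral.integral_neg, ← intervalIntegral.integral_const_mul,
    ← intervalIntegral.integral_const_mul]
  refine Eq.trans ?_ (hswap.trans ?_) <;> refine intervalIntegral.integral_congr fun t _ => ?_
  · push_cast
    ring
  · push_cast
    linear_combination (W / T * t * f t : ℂ) ^ 2 * μ * I_sq

lemma integral_deriv_sq (hW : 0 < W) (hT : 0 < T) (h : IsProlate W T g f) :
    ∫ t in (-T)..T, deriv f t ^ 2 =
      g * (∫ t, deriv f t ^ 2) + spheroidalEigenvalue W T f / T * f T ^ 2 := by
  have hderiv : ContDiff ℝ 1 (deriv f) :=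
    ((contDiff_succ_iff_deriv (n := 1)).1 (h.contDiff hW hT 2)).2.2
  have hparts := intervalIntegral.integral_mul_deriv_eq_deriv_mul (a := -T) (b := T)
    (fun t _ => h.hasDerivAt hW hT t)
    (fun t _ => (hderiv.differentiable one_ne_zero t).hasDerivAt)
    (hderiv.continuous.intervalIntegrable _ _)
    ((hderiv.continuous_deriv le_rfl).intervalIntegrable _ _)
  have henergy := h.integral_iteratedDeriv_sq hW hT 1
  simp only [iteratedDeriv_one, pow_one] at henergy
  rw [h.integral_mul_deriv_deriv hW hT, h.mul_deriv_endpoint_eq hW hT,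
    h.mul_deriv_neg_endpoint_eq hW hT, ← henergy] at hparts
  simp only [← sq] at hparts
  linear_combination hparts

lemma one_sub_eq (hW : 0 < W) (hT : 0 < T) (h : IsProlate W T g f) :
    1 - g = 2 * ∫ t in Ioi T, f t ^ 2 := by
  have hsplit :=
    integral_eq_interval_add_two_mul_Ioi h.memLp.integrable_sq (h.sq_neg hW hT) T
  rw [h.norm_one, h.integral_sq hW hT] at hsplit
  linarith

lemma two_mul_integral_Ioi_deriv_sq (hW : 0 < W) (hT : 0 < T) (h : IsProlate W T g f) :
    2 * ∫ t in Ioi T, deriv f t ^ 2 =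
      (1 - g) * (∫ t, deriv f t ^ 2) - spheroidalEigenvalue W T f / T * f T ^ 2 := by
  have hderiv := h.memLp_iteratedDeriv hW hT 1
  rw [iteratedDeriv_one] at hderiv
  have hsplit :=
    integral_eq_interval_add_two_mul_Ioi hderiv.integrable_sq (h.deriv_sq_neg hW hT) T
  rw [h.integral_deriv_sq hW hT] at hsplit
  linarith

lemma sq_le_two_mul_sqrt_mul_sqrt (hW : 0 < W) (hT : 0 < T) (h : IsProlate W T g f) {s : ℝ}
    (hs : T ≤ |s|) :
    f s ^ 2 ≤ 2 * (√(∫ t in Ioi T, f t ^ 2) * √(∫ t in Ioi T, deriv f t ^ 2)) := by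
  have hderiv := h.memLp_iteratedDeriv hW hT 1
  rw [iteratedDeriv_one] at hderiv
  have hmono : ∀ {u : ℝ → ℝ}, MemLp u 2 →
      ∫ t in Ioi |s|, u t ^ 2 ≤ ∫ t in Ioi T, u t ^ 2 := fun hu =>
    setIntegral_mono_set hu.integrable_sq.integrableOn (.of_forall fun t => sq_nonneg _)
      (Ioi_subset_Ioi hs).eventuallyLE
  have habs : f s ^ 2 = f |s| ^ 2 := by
    rcases abs_choice s with hs' | hs' <;> rw [hs']
    rw [h.sq_neg hW hT]
  calc f s ^ 2
    _ ≤ 2 * (√(∫ t in Ioi |s|, f t ^ 2) * √(∫ t in Ioi |s|, deriv f t ^ 2)) :=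
        habs ▸ PFD.sq_le_two_mul_sqrt_mul_sqrt (fun t _ => h.hasDerivAt hW hT t)
          (h.memLp.restrict _) (hderiv.restrict _)
    _ ≤ _ := by gcongr 2 * (√?_ * √?_) <;> [exact hmono h.memLp; exact hmono hderiv]

lemma eigenvalue_lt_one (hW : 0 < W) (hT : 0 < T) (h : IsProlate W T g f) : g < 1 := by
  have hnonneg : 0 ≤ ∫ t in Ioi T, f t ^ 2 := integral_nonneg fun t => sq_nonneg _
  suffices ∫ t in Ioi T, f t ^ 2 ≠ 0 by
    linarith [h.one_sub_eq hW hT, hnonneg.lt_of_ne' this]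
  intro hzero
  have hbound := h.sq_le_two_mul_sqrt_mul_sqrt hW hT (le_abs_self T)
  rw [hzero, Real.sqrt_zero, zero_mul, mul_zero] at hbound
  exact h.endpoint_ne_zero hW hT (pow_eq_zero_iff two_ne_zero |>.1 (hbound.antisymm (sq_nonneg _)))

lemma cExtra_eq (hW : 0 < W) (hT : 0 < T) (h : IsProlate W T g f) :
    cExtra W T g f = √((∫ t in Ioi T, deriv f t ^ 2) / ∫ t in Ioi T, f t ^ 2) := by
  have hg : 1 - g ≠ 0 := (sub_pos.2 (h.eigenvalue_lt_one hW hT)).ne'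
  have hderiv := h.two_mul_integral_Ioi_deriv_sq hW hT
  rw [cExtra, ← mul_div_mul_left (∫ t in Ioi T, deriv f t ^ 2) _ (two_ne_zero' ℝ), hderiv,
    ← h.one_sub_eq hW hT]
  congr 1
  field_simp

lemma sq_le_cExtra (hW : 0 < W) (hT : 0 < T) (h : IsProlate W T g f) {s : ℝ} (hs : T ≤ |s|) :
    f s ^ 2 ≤ (1 - g) * cExtra W T g f := by
  refine (h.sq_le_two_mul_sqrt_mul_sqrt hW hT hs).trans_eq ?_
  have htail : 0 ≤ ∫ t in Ioi T, f t ^ 2 := integral_nonneg fun t => sq_nonneg _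
  rw [h.cExtra_eq hW hT, h.one_sub_eq hW hT, Real.sqrt_div' _ htail, mul_assoc, mul_div_left_comm,
    Real.div_sqrt, mul_comm √(∫ t in Ioi T, f t ^ 2)]

protected lemma dual (hW : 0 < W) (hT : 0 < T) (h : IsProlate W T g f) :
    IsProlate T W g (dual W T f) := by
  have hr : 0 < T / W := div_pos hT hW
  have hcont : Continuous f := (h.contDiff hW hT 0).continuous
  have hsq : ∀ w, PFD.dual W T f w ^ 2 = T / W * f (T / W * w) ^ 2 := fun w => by
    rw [PFD.dual, mul_pow, Real.sq_sqrt hr.le]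
  refine ⟨?_, fun s => ?_, h.pos, ?_⟩
  · refine (memLp_two_iff_integrable_sq ?_).2 ?_
    · exact Continuous.aestronglyMeasurable (by unfold PFD.dual; fun_prop)
    · simpa only [hsq] using (h.memLp.integrable_sq.comp_mul_left' hr.ne').const_mul (T / W)
  · have hrho : ∀ t, rho T (s - t) = T / W * rho W (T / W * s - T / W * t) := fun t => by
      rw [rho, rho, show W * (T / W * s - T / W * t) = T * (s - t) by field_simp]
      field_simp
    have hscale := intervalIntegral.mul_integral_comp_mul_left (a := -W) (b := W) (c := T / W)
      (f := fun t => rho W (T / W * s - t) * f t)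
    rw [mul_neg, div_mul_cancel₀ T hW.ne', h.eigen] at hscale
    calc ∫ t in (-W)..W, rho T (s - t) * PFD.dual W T f t
      _ = √(T / W) * (T / W *
            ∫ t in (-W)..W, rho W (T / W * s - T / W * t) * f (T / W * t)) := by
          rw [← intervalIntegral.integral_const_mul, ← intervalIntegral.integral_const_mul]
          refine intervalIntegral.integral_congr fun t _ => ?_
          simp only [hrho, PFD.dual]
          ring
      _ = g * PFD.dual W T f s := by
          rw [hscale, PFD.dual, mul_left_comm]
  · simp only [hsq]
    rw [integral_const_mul, Measure.integral_comp_mul_left (fun x => f x ^ 2), h.norm_one,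
      abs_of_pos (inv_pos.2 hr), smul_eq_mul, mul_one, mul_inv_cancel₀ hr.ne']

end IsProlate

section RankOneSums

open Matrix

lemma star_mulVec_dotProduct_mulVec {m n : Type*} [Fintype m] [Fintype n]
    (N : Matrix m n ℂ) (X : Matrix m m ℂ) (x : n → ℂ) :
    star (N *ᵥ x) ⬝ᵥ X *ᵥ (N *ᵥ x) = star x ⬝ᵥ (Nᴴ * X * N) *ᵥ x := by
  rw [star_mulVec, ← dotProduct_mulVec, mulVec_mulVec, mulVec_mulVec, Matrix.mul_assoc]

lemma re_star_dotProduct_self {n : Type*} [Fintype n] (x : n → ℂ) :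
    (star x ⬝ᵥ x).re = ∑ i, ‖x i‖ ^ 2 := by
  simp only [dotProduct, Pi.star_apply, RCLike.star_def, conj_mul', re_sum, ← ofReal_pow, ofReal_re]

lemma re_star_dotProduct_diagonal_mulVec {n : Type*} [Fintype n] [DecidableEq n] (d : n → ℝ)
    (x : n → ℂ) :
    (star x ⬝ᵥ diagonal (fun i => (d i : ℂ)) *ᵥ x).re = ∑ i, d i * ‖x i‖ ^ 2 := by
  simp only [dotProduct, mulVec_diagonal, Pi.star_apply, RCLike.star_def, mul_left_comm _ (d _ : ℂ),
    conj_mul', re_sum, ← ofReal_pow, ← ofReal_mul, ofReal_re]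

lemma norm_sq_star_dotProduct_le {n : Type*} [Fintype n] (x y : n → ℂ) :
    ‖star x ⬝ᵥ y‖ ^ 2 ≤ (∑ i, ‖x i‖ ^ 2) * ∑ i, ‖y i‖ ^ 2 := by
  have hcauchy := norm_inner_le_norm (𝕜 := ℂ) (WithLp.toLp 2 x) (WithLp.toLp 2 y)
  rw [EuclideanSpace.inner_toLp_toLp, dotProduct_comm] at hcauchy
  simpa only [mul_pow, EuclideanSpace.norm_sq_eq] using pow_le_pow_left₀ (norm_nonneg _) hcauchy 2

lemma sum_norm_sq_mulVec_of_conjTranspose_mul_self {m n : Type*} [Fintype m] [Fintype n]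
    [DecidableEq n] {N : Matrix m n ℂ} (hN : Nᴴ * N = 1) (x : n → ℂ) :
    ∑ i, ‖(N *ᵥ x) i‖ ^ 2 = ∑ j, ‖x j‖ ^ 2 := by
  classical
  have h := star_mulVec_dotProduct_mulVec N 1 x
  rw [one_mulVec, Matrix.mul_one, hN, one_mulVec] at h
  rw [← re_star_dotProduct_self, h, re_star_dotProduct_self]

/-- `X` is the sum of the rank-one matrices `q k • v k (v k)†`. The Gram and Hamiltonian matrices of
a signal are of this form, with one summand for each frequency. -/
def HasRankOneSum {ι n : Type*} (q : ι → ℝ) (v : ι → n → ℂ) (X : Matrix n n ℂ) : Prop :=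
  HasSum (fun k => (q k : ℂ) • vecMulVec (v k) (star (v k))) X

namespace HasRankOneSum

variable {ι m n : Type*} {q : ι → ℝ} {v : ι → m → ℂ} {X : Matrix m m ℂ}

lemma of_apply (h : ∀ s l, HasSum (fun k => (q k : ℂ) * v k s * (starRingEnd ℂ) (v k l)) (X s l)) :
    HasRankOneSum q v X :=
  Pi.hasSum.2 fun s => Pi.hasSum.2 fun l => by simpa [vecMulVec_apply, mul_assoc] using h s l

protected lemma neg (h : HasRankOneSum q v X) : HasRankOneSum (fun k => -q k) v (-X) := by
  simpa only [HasRankOneSum, ofReal_neg, neg_smul] using HasSum.neg h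

lemma conjTranspose_mul_mul [Fintype m] (h : HasRankOneSum q v X) (N : Matrix m n ℂ) :
    HasRankOneSum q (fun k => Nᴴ *ᵥ v k) (Nᴴ * X * N) := by
  have hmap := h.map
    (AddMonoidHom.mk' (fun Y : Matrix m m ℂ => Nᴴ * Y * N) fun Y Z => by
      rw [Matrix.mul_add, Matrix.add_mul])
    ((continuous_const.matrix_mul continuous_id).matrix_mul continuous_const)
  simpa [HasRankOneSum, Function.comp_def, mul_vecMulVec, vecMulVec_mul, star_mulVec] using hmap

lemma hasSum_re_quadraticForm [Fintype m] (h : HasRankOneSum q v X) (y : m → ℂ) :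
    HasSum (fun k => q k * ‖star (v k) ⬝ᵥ y‖ ^ 2) (star y ⬝ᵥ X *ᵥ y).re := by
  have hmap := h.map
    (AddMonoidHom.mk' (fun Y : Matrix m m ℂ => (star y ⬝ᵥ Y *ᵥ y).re) fun Y Z => by
      rw [add_mulVec, dotProduct_add, add_re])
    (continuous_re.comp <|
      continuous_const.dotProduct (continuous_id.matrix_mulVec continuous_const))
  convert! hmap using 1
  ext k
  have hconj : star y ⬝ᵥ v k = (starRingEnd ℂ) (star (v k) ⬝ᵥ y) := by
    rw [← RCLike.star_def, star_dotProduct]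
  simp only [Function.comp_apply, AddMonoidHom.mk'_apply, smul_mulVec, vecMulVec_mulVec,
    dotProduct_smul, smul_eq_mul, MulOpposite.smul_eq_mul_unop, MulOpposite.unop_op, hconj,
    conj_mul', re_ofReal_mul, ← ofReal_pow, ofReal_re]

end HasRankOneSum

end RankOneSums

section Minimax

open Matrix

variable {ι : Type*} {m : ℕ} {A B : Matrix (Fin m) (Fin m) ℂ} {μ : Fin m → ℝ}

lemma exists_ne_zero_mulVec_eq_zero_of_card_lt {m n : Type*} [Fintype m] [Fintype n]
    (R : Matrix m n ℂ) (h : Fintype.card m < Fintype.card n) : ∃ c, c ≠ 0 ∧ R *ᵥ c = 0 := by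
  have hker : R.mulVecLin.ker ≠ ⊥ := LinearMap.ker_ne_bot_of_finrank_lt (by simpa using h)
  obtain ⟨c, hc, hc0⟩ := (Submodule.ne_bot_iff _).1 hker
  exact ⟨c, hc0, hc⟩

namespace IsGEPEigenvalues

/-- The vector is found in the span of the first `i + 1` generalized eigenvectors, whose dimension
exceeds the number of orthogonality conditions. -/
lemma exists_orthogonal_rayleigh_ge (h : IsGEPEigenvalues A B μ) (i : Fin m) {K : Finset ι}
    (hK : K.card ≤ i) (v : ι → Fin m → ℂ) :
    ∃ x, (∀ k ∈ K, star (v k) ⬝ᵥ x = 0) ∧ 0 < (star x ⬝ᵥ B *ᵥ x).re ∧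
      μ i * (star x ⬝ᵥ B *ᵥ x).re ≤ (star x ⬝ᵥ A *ᵥ x).re := by
  obtain ⟨hμ, Φ, hB, hA⟩ := h
  have hAdiag : Φᴴ * A * Φ = diagonal fun j => (μ j : ℂ) := by
    rw [Matrix.mul_assoc, hA, ← Matrix.mul_assoc, ← Matrix.mul_assoc, hB, Matrix.one_mul]
  let Ψ : Matrix (Fin m) (Finset.Iic i) ℂ := Φ.submatrix id Subtype.val
  have hΨB : Ψᴴ * B * Ψ = 1 := by
    rw [← submatrix_one _ Subtype.val_injective, ← hB]
    rfl
  have hΨA : Ψᴴ * A * Ψ = diagonal fun j : Finset.Iic i => (μ j : ℂ) := by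
    have hsub := submatrix_diagonal (fun j => (μ j : ℂ)) (Subtype.val : Finset.Iic i → Fin m)
      Subtype.val_injective
    rwa [← hAdiag] at hsub
  obtain ⟨c, hc0, hc⟩ := exists_ne_zero_mulVec_eq_zero_of_card_lt
    (Matrix.of fun k : K => star (v k) ᵥ* Ψ)
    (by simp only [Fintype.card_coe, Fin.card_Iic]; lia)
  have hquadB : (star (Ψ *ᵥ c) ⬝ᵥ B *ᵥ (Ψ *ᵥ c)).re = ∑ j, ‖c j‖ ^ 2 := by
    rw [star_mulVec_dotProduct_mulVec, hΨB, one_mulVec, re_star_dotProduct_self]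
  have hquadA : (star (Ψ *ᵥ c) ⬝ᵥ A *ᵥ (Ψ *ᵥ c)).re =
      ∑ j : Finset.Iic i, μ j * ‖c j‖ ^ 2 := by
    rw [star_mulVec_dotProduct_mulVec, hΨA, re_star_dotProduct_diagonal_mulVec]
  refine ⟨Ψ *ᵥ c, fun k hk => ?_, ?_, ?_⟩
  · rw [dotProduct_mulVec]
    exact congrFun hc ⟨k, hk⟩
  · obtain ⟨j, hj⟩ := Function.ne_iff.1 hc0
    rw [hquadB]
    exact Finset.sum_pos' (fun j _ => sq_nonneg _)
      ⟨j, Finset.mem_univ j, pow_pos (norm_pos_iff.2 hj) 2⟩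
  · rw [hquadA, hquadB, Finset.mul_sum]
    exact Finset.sum_le_sum fun j _ =>
      mul_le_mul_of_nonneg_right (hμ (Finset.mem_Iic.1 j.2)) (sq_nonneg _)

variable {p ω : ι → ℝ} {v : ι → Fin m → ℂ} {L ε z : ℝ} {s : Set ι} {K : Finset ι}

lemma sub_le (h : IsGEPEigenvalues A B μ) (hp : ∀ k, 0 ≤ p k)
    (hB : HasRankOneSum p v B) (hA : HasRankOneSum (fun k => ω k * p k) v A)
    (hsum : Summable fun k => (ω k - z) * p k) (hL : 0 < L)
    (hLB : ∀ x, L * ∑ j, ‖x j‖ ^ 2 ≤ (star x ⬝ᵥ B *ᵥ x).re) (hε : 0 ≤ ε)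
    (hv : ∀ k ∈ s, ∑ j, ‖v k j‖ ^ 2 ≤ ε) (hs : ∀ k ∈ s, z ≤ ω k)
    (hrest : ∀ k ∉ s, k ∉ K → ω k ≤ z) (i : Fin m) (hK : K.card ≤ i) :
    μ i - z ≤ ε * (∑' k : s, (ω k - z) * p k) / L := by
  obtain ⟨x, hxK, hx, hray⟩ := h.exists_orthogonal_rayleigh_ge i hK v
  set b := (star x ⬝ᵥ B *ᵥ x).re
  set X := ∑ j, ‖x j‖ ^ 2
  set S := ∑' k : s, (ω k - z) * p k with hSdef
  have hX : 0 ≤ X := Finset.sum_nonneg fun j _ => sq_nonneg _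
  have hS : 0 ≤ S := tsum_nonneg fun k => mul_nonneg (sub_nonneg.2 (hs k k.2)) (hp k)
  have hterm : ∀ k, ω k * p k * ‖star (v k) ⬝ᵥ x‖ ^ 2 - z * (p k * ‖star (v k) ⬝ᵥ x‖ ^ 2) ≤
      s.indicator (fun k => (ω k - z) * p k) k * (ε * X) := by
    intro k
    rw [← mul_assoc, ← sub_mul, ← sub_mul]
    by_cases hks : k ∈ s
    · rw [indicator_of_mem hks]
      exact mul_le_mul_of_nonneg_left ((norm_sq_star_dotProduct_le _ _).trans
        (mul_le_mul_of_nonneg_right (hv k hks) hX))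
        (mul_nonneg (sub_nonneg.2 (hs k hks)) (hp k))
    · rw [indicator_of_notMem hks, zero_mul]
      by_cases hkK : k ∈ K
      · simp [hxK k hkK]
      · exact mul_nonpos_of_nonpos_of_nonneg (mul_nonpos_of_nonpos_of_nonneg
          (sub_nonpos.2 (hrest k hks hkK)) (hp k)) (sq_nonneg _)
  have hquad : (star x ⬝ᵥ A *ᵥ x).re - z * b ≤ S * (ε * X) := by
    rw [hSdef, tsum_subtype s fun k => (ω k - z) * p k]
    exact hasSum_le hterm
      ((hA.hasSum_re_quadraticForm x).sub ((hB.hasSum_re_quadraticForm x).mul_left z))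
      ((hsum.indicator s).hasSum.mul_right (ε * X))
  rw [le_div_iff₀ hL]
  refine le_of_mul_le_mul_right ?_ hx
  calc (μ i - z) * L * b = L * (μ i * b - z * b) := by ring
    _ ≤ L * (S * (ε * X)) := by gcongr; linarith
    _ = ε * S * (L * X) := by ring
    _ ≤ ε * S * b := by gcongr; exact hLB x

lemma neg_rev (h : IsGEPEigenvalues A B μ) :
    IsGEPEigenvalues (-A) B fun i => -μ (Fin.rev i) := by
  obtain ⟨hμ, Φ, hB, hA⟩ := h
  refine ⟨fun i j hij => neg_le_neg (hμ (Fin.rev_le_rev.2 hij)), Φ.submatrix id Fin.rev, ?_, ?_⟩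
  · rw [← submatrix_one _ Fin.rev_injective, ← hB]
    rfl
  · have hcols : A * Φ.submatrix id Fin.rev =
        B * Φ.submatrix id Fin.rev * diagonal fun i => (μ (Fin.rev i) : ℂ) :=
      (congrArg (fun Y => Y.submatrix id Fin.rev) hA).trans <|
        (submatrix_mul_equiv _ _ _ Fin.revPerm _).symm.trans <|
          congrArg (B * Φ.submatrix id Fin.rev * ·) (submatrix_diagonal _ _ Fin.rev_injective)
    simp only [ofReal_neg, ← diagonal_neg, Matrix.neg_mul, Matrix.mul_neg, hcols]

lemma le_sub (h : IsGEPEigenvalues A B μ) (hp : ∀ k, 0 ≤ p k)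
    (hB : HasRankOneSum p v B) (hA : HasRankOneSum (fun k => ω k * p k) v A)
    (hsum : Summable fun k => (ω k - z) * p k) (hL : 0 < L)
    (hLB : ∀ x, L * ∑ j, ‖x j‖ ^ 2 ≤ (star x ⬝ᵥ B *ᵥ x).re) (hε : 0 ≤ ε)
    (hv : ∀ k ∈ s, ∑ j, ‖v k j‖ ^ 2 ≤ ε) (hs : ∀ k ∈ s, ω k ≤ z)
    (hrest : ∀ k ∉ s, k ∉ K → z ≤ ω k) (i : Fin m) (hK : K.card ≤ Fin.rev i) :
    ε * (∑' k : s, (ω k - z) * p k) / L ≤ μ i - z := by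
  have hneg : ∀ k, (-ω k - -z) * p k = -((ω k - z) * p k) := fun k => by ring
  have hupper := h.neg_rev.sub_le (ω := fun k => -ω k) (z := -z) hp hB
    (by simpa only [neg_mul] using hA.neg) (by simpa only [hneg] using hsum.neg) hL hLB hε hv
    (fun k hk => neg_le_neg (hs k hk)) (fun k hks hkK => neg_le_neg (hrest k hks hkK)) _ hK
  simp only [Fin.rev_rev, hneg, tsum_neg, mul_neg, neg_div] at hupper
  linarith

end IsGEPEigenvalues

end Minimax

section TermwiseIntegration

variable {ι : Type*} {a b : ℝ}

lemma hasSum_intervalIntegral_of_norm_le {F : ι → ℝ → ℂ} {c : ι → ℝ}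
    (hF : ∀ k, Continuous (F k)) (hb : ∀ k, ∀ t ∈ uIcc a b, ‖F k t‖ ≤ c k) (hc : Summable c) :
    HasSum (fun k => ∫ t in a..b, F k t) (∫ t in a..b, ∑' k, F k t) := by
  have hzero : ∀ k ∉ Function.support c, ∀ t ∈ uIcc a b, F k t = 0 := fun k hk t ht =>
    norm_le_zero_iff.1 ((hb k t ht).trans_eq (Function.notMem_support.1 hk))
  have hintegral : Function.support (fun k => ∫ t in a..b, F k t) ⊆ Function.support c :=
    Function.support_subset_iff'.2 fun k hk => by
      rw [intervalIntegral.integral_congr (g := 0) (hzero k hk)]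
      exact intervalIntegral.integral_zero
  -- Dominated convergence needs a countable index type.
  have : Countable (Function.support c) := hc.countable_support
  refine (hasSum_subtype_iff_of_support_subset hintegral).1 <|
    intervalIntegral.hasSum_integral_of_dominated_convergence (fun k _ => c k)
      (fun k => (hF k).aestronglyMeasurable)
      (fun k => Eventually.of_forall fun t ht => hb k t (uIoc_subset_uIcc ht))
      (Eventually.of_forall fun t _ => hc.subtype _) intervalIntegrable_const
      (Eventually.of_forall fun t ht => ?_)
  have ht' := uIoc_subset_uIcc ht
  exact (hasSum_subtype_iff_of_support_subset
    (Function.support_subset_iff'.2 fun k hk => hzero k hk t ht')).2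
    (Summable.of_norm_bounded hc fun k => hb k t ht').hasSum

lemma hasSum_intervalIntegral_intervalIntegral_mul {q : ι → ℂ} (hq : Summable fun k => ‖q k‖)
    {φ ψ : ι → ℝ → ℂ} (hφ : ∀ k, Continuous (φ k)) (hψ : ∀ k, Continuous (ψ k)) {C D : ℝ}
    (hC : ∀ k, ∀ τ ∈ uIcc a b, ‖φ k τ‖ ≤ C) (hD : ∀ k, ∀ t ∈ uIcc a b, ‖ψ k t‖ ≤ D) :
    HasSum (fun k => q k * (∫ τ in a..b, φ k τ) * ∫ t in a..b, ψ k t)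
      (∫ t in a..b, ∫ τ in a..b, ∑' k, q k * φ k τ * ψ k t) := by
  have hinner : ∀ t ∈ uIcc a b, ∫ τ in a..b, ∑' k, q k * φ k τ * ψ k t =
      ∑' k, q k * (∫ τ in a..b, φ k τ) * ψ k t := by
    intro t ht
    refine (hasSum_intervalIntegral_of_norm_le (c := fun k => ‖q k‖ * C * D) (by fun_prop)
      (fun k τ hτ => ?_) ((hq.mul_right C).mul_right D)).tsum_eq.symm.trans ?_
    · rw [norm_mul, norm_mul]
      have hC0 := (norm_nonneg _).trans (hC k τ hτ)
      gcongr
      exacts [hC k τ hτ, hD k t ht]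
    · simp only [intervalIntegral.integral_mul_const, intervalIntegral.integral_const_mul]
  have houter := hasSum_intervalIntegral_of_norm_le (a := a) (b := b)
    (F := fun k t => q k * (∫ τ in a..b, φ k τ) * ψ k t)
    (c := fun k => ‖q k‖ * (C * |b - a|) * D) (by fun_prop) (fun k t ht => by
      rw [norm_mul, norm_mul]
      have hC0 := (norm_nonneg _).trans (hC k a left_mem_uIcc)
      gcongr
      · exact intervalIntegral.norm_integral_le_of_norm_le_const fun τ hτ =>
          hC k τ (uIoc_subset_uIcc hτ)
      · exact hD k t ht) ((hq.mul_right _).mul_right _)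
  rw [intervalIntegral.integral_congr hinner]
  simpa only [intervalIntegral.integral_const_mul] using houter

end TermwiseIntegration

section SignalMatrices

variable {ι : Type*} {T : ℝ} {ωs : ℝ} {ξ : ℕ → ℝ → ℝ} {M : ℕ}

/-- The amplitude with which the window `f`, modulated by the filter centre `ωs`, passes the
frequency `w`. -/
def filterAmp (T ωs : ℝ) (f : ℝ → ℝ) (w : ℝ) : ℂ :=
  finFourier 1 T (fun t => (f t : ℂ)) (w - ωs)

lemma hasSum_filtered {q ω : ι → ℝ} (hq : Summable fun k => ‖(q k : ℂ)‖) {f g : ℝ → ℝ}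
    (hf : Continuous f) (hg : Continuous g) :
    HasSum (fun k => (q k : ℂ) * filterAmp T ωs f (ω k) * (starRingEnd ℂ) (filterAmp T ωs g (ω k)))
      (∫ t in (-T)..T, ∫ τ in (-T)..T, cexp (-I * ωs * (τ - t)) * f τ * g t *
        ∑' k, (q k : ℂ) * cexp (I * ω k * (τ - t : ℝ))) := by
  obtain ⟨C, hC⟩ := (isCompact_uIcc (a := -T) (b := T)).exists_bound_of_continuousOn hf.continuousOn
  obtain ⟨D, hD⟩ := (isCompact_uIcc (a := -T) (b := T)).exists_bound_of_continuousOn hg.continuousOn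
  have hsep : ∀ t τ : ℝ, ∀ k, cexp (-I * ωs * (τ - t)) * f τ * g t *
      ((q k : ℂ) * cexp (I * ω k * (τ - t : ℝ))) =
      (q k : ℂ) * (expKernel 1 (ω k - ωs) τ * f τ) * (expKernel 1 (-(ω k - ωs)) t * g t) := by
    intro t τ k
    have hexp : cexp (-I * ωs * (τ - t)) * cexp (I * ω k * (τ - t : ℝ)) =
        expKernel 1 (ω k - ωs) τ * expKernel 1 (-(ω k - ωs)) t := by
      rw [expKernel, expKernel, ← Complex.exp_add, ← Complex.exp_add]
      congr 1
      push_cast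
      ring
    linear_combination ((q k : ℂ) * f τ * g t) * hexp
  simp only [← tsum_mul_left, hsep, filterAmp, conj_finFourier_ofReal]
  refine hasSum_intervalIntegral_intervalIntegral_mul hq (by fun_prop) (by fun_prop) (C := C)
    (D := D) (fun k τ hτ => ?_) (fun k t ht => ?_)
  · simpa [norm_expKernel] using hC τ hτ
  · simpa [norm_expKernel] using hD t ht

lemma hasRankOneSum_gramMatrix {a : ι → ℂ} {ω : ι → ℝ} (ha : Summable fun k => ‖a k‖ ^ 2)
    (hξ : ∀ l < M, Continuous (ξ l)) :
    HasRankOneSum (fun k => ‖a k‖ ^ 2) (fun k (l : Fin M) => filterAmp T ωs (ξ l) (ω k))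
      (gramMatrix T ωs ξ (signal a ω) M) :=
  .of_apply fun s l => hasSum_filtered (by simpa using ha) (hξ s s.2) (hξ l l.2)

lemma deriv_signal_sub {a : ι → ℂ} {ω : ι → ℝ} (ha : Summable fun k => ‖a k‖ ^ 2)
    (haω : Summable fun k => |ω k| * ‖a k‖ ^ 2) (τ t : ℝ) :
    deriv (fun u : ℝ => signal a ω (τ - u)) t =
      -I * ∑' k, ((ω k * ‖a k‖ ^ 2 : ℝ) : ℂ) * cexp (I * ω k * (τ - t : ℝ)) := by
  have hnorm : ∀ k (u : ℝ), ‖cexp (I * ω k * (τ - u : ℝ))‖ = 1 := by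
    intro k u
    rw [mul_assoc, mul_comm I, ← ofReal_mul, norm_exp_ofReal_mul_I]
  have hterm : ∀ k (u : ℝ), HasDerivAt
      (fun u : ℝ => ((‖a k‖ ^ 2 : ℝ) : ℂ) * cexp (I * ω k * (τ - u : ℝ)))
      (-I * (((ω k * ‖a k‖ ^ 2 : ℝ) : ℂ) * cexp (I * ω k * (τ - u : ℝ)))) u := by
    intro k u
    have hphase : HasDerivAt (fun u : ℝ => I * ω k * ((τ - u : ℝ) : ℂ))
        (I * ω k * ((-1 : ℝ) : ℂ)) u :=
      (((hasDerivAt_id u).const_sub τ).ofReal_comp).const_mul _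
    convert! hphase.cexp.const_mul (((‖a k‖ ^ 2 : ℝ) : ℂ)) using 1
    push_cast
    ring
  rw [← tsum_mul_left]
  refine (hasDerivAt_tsum haω hterm (fun k u => ?_) (y₀ := t)
    (Summable.of_norm_bounded ha fun k => ?_) t).deriv
  · simp [hnorm, -ofReal_sub]
  · simp [hnorm, -ofReal_sub]

lemma hasRankOneSum_hamMatrix {a : ι → ℂ} {ω : ι → ℝ} (ha : Summable fun k => ‖a k‖ ^ 2)
    (haω : Summable fun k => |ω k| * ‖a k‖ ^ 2) (hξ : ∀ l < M, Continuous (ξ l)) :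
    HasRankOneSum (fun k => ω k * ‖a k‖ ^ 2) (fun k (l : Fin M) => filterAmp T ωs (ξ l) (ω k))
      (hamMatrix T ωs ξ (signal a ω) M) := by
  refine .of_apply fun s l => ?_
  convert! hasSum_filtered (q := fun k => ω k * ‖a k‖ ^ 2) (by simpa using haω) (hξ s s.2)
    (hξ l l.2) using 1
  simp only [hamMatrix, Matrix.of_apply, deriv_signal_sub ha haω,
    ← intervalIntegral.integral_const_mul]
  congr 1 with t
  congr 1 with τ
  linear_combination (-(cexp (-I * ωs * (τ - t)) * ξ s τ * ξ l t *
    ∑' k, ((ω k * ‖a k‖ ^ 2 : ℝ) : ℂ) * cexp (I * ω k * (τ - t : ℝ)))) * I_sq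

lemma re_signal_zero_nonneg (a : ι → ℂ) (ω : ι → ℝ) : 0 ≤ (signal a ω 0).re := by
  simp only [signal, ofReal_zero, mul_zero, exp_zero, mul_one, ← ofReal_tsum, ofReal_re]
  exact tsum_nonneg fun k => sq_nonneg _

end SignalMatrices

section Leakage

variable {W T : ℝ}

lemma IsProlate.norm_filterAmp_sq {g : ℝ} {f : ℝ → ℝ} (hW : 0 < W) (hT : 0 < T)
    (h : IsProlate W T g f) (ωs w : ℝ) :
    ‖filterAmp T ωs f w‖ ^ 2 = 2 * Real.pi * g * dual W T f (w - ωs) ^ 2 := by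
  obtain ⟨μ, hμnorm, hμ⟩ := h.exists_finFourier_eq hW hT
  have hrescale : filterAmp T ωs f w = μ * f (T / W * (w - ωs)) := by
    have hscale : W / T * (T / W * (w - ωs)) = 1 * (w - ωs) := by field_simp
    simp only [← hμ, filterAmp, finFourier, expKernel, hscale]
  rw [hrescale, norm_mul, mul_pow, hμnorm, norm_real, Real.norm_eq_abs, sq_abs, dual, mul_pow,
    Real.sq_sqrt (by positivity)]
  field_simp

lemma IsProlate.norm_filterAmp_sq_le {g : ℝ} {f : ℝ → ℝ} (hW : 0 < W) (hT : 0 < T)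
    (h : IsProlate W T g f) {ωs w : ℝ} (hw : W ≤ |w - ωs|) :
    ‖filterAmp T ωs f w‖ ^ 2 ≤ 2 * Real.pi * (g * (1 - g) * cExtra T W g (dual W T f)) := by
  have hdecay := (h.dual hW hT).sq_le_cExtra hT hW hw
  have hg := h.pos
  calc ‖filterAmp T ωs f w‖ ^ 2 = 2 * Real.pi * g * dual W T f (w - ωs) ^ 2 :=
        h.norm_filterAmp_sq hW hT ωs w
    _ ≤ 2 * Real.pi * g * ((1 - g) * cExtra T W g (dual W T f)) := by gcongr
    _ = 2 * Real.pi * (g * (1 - g) * cExtra T W g (dual W T f)) := by ring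

variable {γ : ℕ → ℝ} {ξ : ℕ → ℝ → ℝ} {M : ℕ}

lemma sum_norm_filterAmp_sq_le_epsTilde (hW : 0 < W) (hT : 0 < T)
    (hξ : ∀ l < M, IsProlate W T (γ l) (ξ l)) {ωs w : ℝ} (hw : W ≤ |w - ωs|) :
    ∑ l : Fin M, ‖filterAmp T ωs (ξ l) w‖ ^ 2 ≤ epsTilde W T γ ξ M := by
  rw [Fin.sum_univ_eq_sum_range fun l => ‖filterAmp T ωs (ξ l) w‖ ^ 2, epsTilde, Finset.mul_sum]
  exact Finset.sum_le_sum fun l hl =>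
    (hξ l (Finset.mem_range.1 hl)).norm_filterAmp_sq_le hW hT hw

lemma epsTilde_nonneg (hW : 0 < W) (hT : 0 < T) (hξ : ∀ l < M, IsProlate W T (γ l) (ξ l)) :
    0 ≤ epsTilde W T γ ξ M :=
  (Finset.sum_nonneg fun _ _ => sq_nonneg _).trans <|
    sum_norm_filterAmp_sq_le_epsTilde hW hT hξ (ωs := 0) (w := W)
      ((le_abs_self W).trans_eq (by rw [sub_zero]))

end Leakage

section Refinement

open Matrix

variable {m M : ℕ} (h : m ≤ M) {U V : Matrix (Fin M) (Fin M) ℂ} {lam : Fin M → ℝ}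

lemma Diagonalizes.refinedHam_eq (hU : Diagonalizes V U lam) :
    refinedHam h U V = refinedGram h lam := by
  rw [refinedHam, hU.2.2]
  exact submatrix_diagonal _ _ (Fin.castLE_injective h)

lemma Diagonalizes.mul_sum_le_refinedGram (hU : Diagonalizes V U lam) {L : ℝ} {j : Fin M}
    (hm : m ≤ j + 1) (hL : L ≤ lam j) (x : Fin m → ℂ) :
    L * ∑ i, ‖x i‖ ^ 2 ≤ (star x ⬝ᵥ refinedGram h lam *ᵥ x).re := by
  rw [refinedGram, re_star_dotProduct_diagonal_mulVec, Finset.mul_sum]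
  refine Finset.sum_le_sum fun i _ =>
    mul_le_mul_of_nonneg_right (hL.trans (hU.2.1 ?_)) (sq_nonneg _)
  exact Fin.le_def.2 (by simp only [Fin.val_castLE]; lia)

variable {ι : Type*} {q : ι → ℝ} {v : ι → Fin M → ℂ}

lemma HasRankOneSum.refinedHam (hV : HasRankOneSum q v V) (U : Matrix (Fin M) (Fin M) ℂ) :
    HasRankOneSum q (fun k => (Uᴴ *ᵥ v k) ∘ Fin.castLE h) (refinedHam h U V) :=
  hV.conjTranspose_mul_mul (U.submatrix id (Fin.castLE h))

lemma sum_norm_sq_comp_castLE_le (hU : U ∈ unitaryGroup (Fin M) ℂ) (x : Fin M → ℂ) :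
    ∑ i, ‖((Uᴴ *ᵥ x) ∘ Fin.castLE h) i‖ ^ 2 ≤ ∑ j, ‖x j‖ ^ 2 := by
  have hUstar : Uᴴᴴ * Uᴴ = 1 := by
    rw [conjTranspose_conjTranspose, ← star_eq_conjTranspose, mem_unitaryGroup_iff.1 hU]
  calc ∑ i, ‖((Uᴴ *ᵥ x) ∘ Fin.castLE h) i‖ ^ 2
      = ∑ j ∈ Finset.univ.map (Fin.castLEEmb h), ‖(Uᴴ *ᵥ x) j‖ ^ 2 := by
        rw [Finset.sum_map]
        rfl
    _ ≤ ∑ j, ‖(Uᴴ *ᵥ x) j‖ ^ 2 := Finset.sum_le_univ_sum_of_nonneg fun _ => sq_nonneg _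
    _ = ∑ j, ‖x j‖ ^ 2 := sum_norm_sq_mulVec_of_conjTranspose_mul_self hUstar x

end Refinement

section Band

open Matrix

variable {ι : Type*} {m : ℕ} {ω : ι → ℝ} {lo hi : ℝ} {idx : Fin m → ι} {i : Fin m}

lemma le_of_notMem_image_Iio [DecidableEq ι] (hidx : Antitone fun i => ω (idx i))
    (hrange : range idx = {k | ω k ∈ Icc lo hi}) {k : ι} (hk : ω k ≤ hi)
    (hki : k ∉ (Finset.Iio i).image idx) : ω k ≤ ω (idx i) := by
  by_cases hlo : lo ≤ ω k
  · obtain ⟨j, rfl⟩ := hrange.superset ⟨hlo, hk⟩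
    exact hidx (not_lt.1 fun hji => hki (Finset.mem_image_of_mem idx (Finset.mem_Iio.2 hji)))
  · exact (not_le.1 hlo).le.trans (hrange.subset (mem_range_self i)).1

lemma le_of_notMem_image_Ioi [DecidableEq ι] (hidx : Antitone fun i => ω (idx i))
    (hrange : range idx = {k | ω k ∈ Icc lo hi}) {k : ι} (hk : lo ≤ ω k)
    (hki : k ∉ (Finset.Ioi i).image idx) : ω (idx i) ≤ ω k := by
  by_cases hhi : ω k ≤ hi
  · obtain ⟨j, rfl⟩ := hrange.superset ⟨hk, hhi⟩
    exact hidx (not_lt.1 fun hij => hki (Finset.mem_image_of_mem idx (Finset.mem_Ioi.2 hij)))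
  · exact (hrange.subset (mem_range_self i)).2.trans (not_le.1 hhi).le

lemma IsGEPEigenvalues.le_sub_and_sub_le {A B : Matrix (Fin m) (Fin m) ℂ} {μ : Fin m → ℝ}
    (h : IsGEPEigenvalues A B μ) {p : ι → ℝ} (hp : ∀ k, 0 ≤ p k) (hpsum : Summable p)
    (hωp : Summable fun k => |ω k| * p k) {v : ι → Fin m → ℂ} (hB : HasRankOneSum p v B)
    (hA : HasRankOneSum (fun k => ω k * p k) v A) {L ε : ℝ} (hL : 0 < L)
    (hLB : ∀ x, L * ∑ j, ‖x j‖ ^ 2 ≤ (star x ⬝ᵥ B *ᵥ x).re) (hε : 0 ≤ ε)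
    (hidx : Antitone fun i => ω (idx i)) (hrange : range idx = {k | ω k ∈ Icc lo hi})
    (hv : ∀ k, ω k ∉ Icc lo hi → ∑ j, ‖v k j‖ ^ 2 ≤ ε) (i : Fin m) :
    ε * (∑' k : {k // ω k < lo}, (ω k - ω (idx i)) * p k) / L ≤ μ i - ω (idx i) ∧
      μ i - ω (idx i) ≤ ε * (∑' k : {k // hi < ω k}, (ω k - ω (idx i)) * p k) / L := by
  classical
  obtain ⟨hlo, hhi⟩ : ω (idx i) ∈ Icc lo hi := hrange.subset (mem_range_self i)
  have hωp' : Summable fun k => ω k * p k :=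
    Summable.of_norm <| by simpa [abs_of_nonneg (hp _)] using hωp
  have hsum : Summable fun k => (ω k - ω (idx i)) * p k := by
    simpa only [sub_mul] using hωp'.sub (hpsum.mul_left _)
  constructor
  · refine h.le_sub (s := {k | ω k < lo}) (K := (Finset.Ioi i).image idx) hp hB hA hsum hL hLB hε
      (fun k hk => hv k fun hk' => hk'.1.not_gt hk) (fun k hk => (mem_ofPred.1 hk).le.trans hlo)
      (fun k hk => le_of_notMem_image_Ioi hidx hrange (not_lt.1 hk)) i ?_
    exact Finset.card_image_le.trans_eq (by rw [Fin.card_Ioi, Fin.val_rev]; lia)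
  · exact h.sub_le (s := {k | hi < ω k}) (K := (Finset.Iio i).image idx) hp hB hA hsum hL hLB hε
      (fun k hk => hv k fun hk' => hk'.2.not_gt hk) (fun k hk => hhi.trans (mem_ofPred.1 hk).le)
      (fun k hk => le_of_notMem_image_Iio hidx hrange (not_lt.1 hk)) i
      (Finset.card_image_le.trans_eq (Fin.card_Iio i))

end Band

end PFD

end

theorem mainTheorem2_general {ι : Type*} (a : ι → ℂ) (ω : ι → ℝ)
    (ha : Summable fun k => ‖a k‖ ^ 2) (haω : Summable fun k => |ω k| * ‖a k‖ ^ 2)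
    (W T ωs : ℝ) (hW : 0 < W) (hT : 0 < T)
    (M : ℕ) (γ : ℕ → ℝ) (ξ : ℕ → ℝ → ℝ) (hξ : ∀ l < M, PFD.IsProlate W T (γ l) (ξ l))
    (m : ℕ) (idx : Fin m → ι) (hidx : Antitone fun i => ω (idx i))
    (hrange : Set.range idx = {k | ω k ∈ Set.Icc (ωs - W) (ωs + W)})
    (hmM : m ≤ M) (U : Matrix (Fin M) (Fin M) ℂ) (lam : Fin M → ℝ)
    (hU : PFD.Diagonalizes (PFD.gramMatrix T ωs ξ (PFD.signal a ω) M) U lam)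
    (ω' : Fin m → ℝ)
    (hω' : PFD.IsGEPEigenvalues
      (PFD.refinedHam hmM U (PFD.hamMatrix T ωs ξ (PFD.signal a ω) M))
      (PFD.refinedGram hmM lam) ω')
    (i : Fin m) (L : ℝ) (hL : 0 < L) (hLlam : L ≤ lam ⟨m - 1, by have := i.pos; omega⟩) :
    PFD.epsTilde W T γ ξ M * (∑' l : {l // ω l < ωs - W}, (ω l - ω (idx i)) * ‖a l‖ ^ 2) / L
      ≤ ω' i - ω (idx i) ∧
    ω' i - ω (idx i) ≤
      PFD.epsTilde W T γ ξ M * (∑' l : {l // ωs + W < ω l}, (ω l - ω (idx i)) * ‖a l‖ ^ 2) / L := by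
  have hcont : ∀ l < M, Continuous (ξ l) := fun l hl => ((hξ l hl).contDiff hW hT 0).continuous
  have hgram := (PFD.hasRankOneSum_gramMatrix (T := T) (ωs := ωs) (ω := ω) ha hcont).refinedHam
    hmM U
  have hham := (PFD.hasRankOneSum_hamMatrix (T := T) (ωs := ωs) ha haω hcont).refinedHam hmM U
  rw [hU.refinedHam_eq] at hgram
  refine hω'.le_sub_and_sub_le (fun k => sq_nonneg ‖a k‖) ha haω hgram hham hL
    (hU.mul_sum_le_refinedGram hmM (by simp only; omega) hLlam) (PFD.epsTilde_nonneg hW hT hξ)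
    hidx hrange (fun k hk => (PFD.sum_norm_sq_comp_castLE_le hmM hU.1 _).trans ?_) i
  refine PFD.sum_norm_filterAmp_sq_le_epsTilde hW hT hξ (not_lt.1 fun hlt => hk ?_)
  exact ⟨by linarith [(abs_lt.1 hlt).1], by linarith [(abs_lt.1 hlt).2]⟩

theorem mainTheorem2 {ι : Type*} (a : ι → ℂ) (ω : ι → ℝ) (hω : Function.Injective ω)
    (ha : Summable fun k => ‖a k‖ ^ 2) (haω : Summable fun k => |ω k| * ‖a k‖ ^ 2)
    (W T ωs : ℝ) (hW : 0 < W) (hT : 0 < T)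
    (γ : ℕ → ℝ) (ξ : ℕ → ℝ → ℝ) (hξ : PFD.IsProlateSequence W T γ ξ)
    -- the `m` frequencies in the band, in decreasing order
    (m : ℕ) (hm : 0 < m) (idx : Fin m → ι) (hidx : StrictAnti fun i => ω (idx i))
    (hrange : Set.range idx = {k | ω k ∈ Set.Icc (ωs - W) (ωs + W)})
    -- the refinement of the `M`-dimensional problem
    (M : ℕ) (hmM : m ≤ M) (U : Matrix (Fin M) (Fin M) ℂ) (lam : Fin M → ℝ)
    (hU : PFD.Diagonalizes (PFD.gramMatrix T ωs ξ (PFD.signal a ω) M) U lam)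
    -- the `m`-th eigenvalue of the Gram matrix lies above the noise level
    (hdetect : PFD.epsTilde W T γ ξ M * (PFD.signal a ω 0).re < lam ⟨m - 1, by omega⟩)
    (ω' : Fin m → ℝ)
    (hω' : PFD.IsGEPEigenvalues
      (PFD.refinedHam hmM U (PFD.hamMatrix T ωs ξ (PFD.signal a ω) M))
      (PFD.refinedGram hmM lam) ω')
    (i : Fin m) :
    PFD.epsTilde W T γ ξ M * (∑' l : {l // ω l < ωs - W}, (ω l - ω (idx i)) * ‖a l‖ ^ 2) /
        (lam ⟨m - 1, by omega⟩ - PFD.epsTilde W T γ ξ M * (PFD.signal a ω 0).re)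
      ≤ ω' i - ω (idx i) ∧
    ω' i - ω (idx i) ≤
      PFD.epsTilde W T γ ξ M * (∑' l : {l // ωs + W < ω l}, (ω l - ω (idx i)) * ‖a l‖ ^ 2) /
        (lam ⟨m - 1, by omega⟩ - PFD.epsTilde W T γ ξ M * (PFD.signal a ω 0).re) := by
  refine mainTheorem2_general a ω ha haω W T ωs hW hT M γ ξ (fun l _ => hξ.isProlate l) m idx
    hidx.antitone hrange hmM U lam hU ω' hω' i _ (sub_pos.2 hdetect) (sub_le_self _ ?_)
  exact mul_nonneg (PFD.epsTilde_nonneg hW hT fun l _ => hξ.isProlate l)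
    (PFD.re_signal_zero_nonneg a ω)
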